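/- Let $k:\mathbb R^2\times\mathbb R^2\to[0,\infty)$ be a bounded kernel such that $k(s,\cdot)$ is Lebesgue integrable for every $s\in\mathbb R^2$. Let $W$ be a Cauchy white noise on $\mathbb R^2$, i.e. an independently scattered, almost surely countably additive random measure such that, for every Borel set $A$ of finite area $|A|$, $W(A)$ has the Cauchy distribution centred at $0$ with scale $|A|$. Let $Z(s)=\int_{\mathbb R^2}k(s,x)\,W(dx)$, $s\in\mathbb R^2$, be the corresponding Cauchy convolution process (the stochastic integral being the limit in probability of integrals of simple functions converging to $k(s,\cdot)$ in $L^1$). Let $Z_G$ be a stationary Gaussian process on $\mathbb R^2$ with $N(0,1)$ margins that is independent of $Z$, let $\beta\ge 0$, and put $\tilde Z(s)=Z(s)+\beta Z_G(s)$. Let $s_1,\dots,s_d\in\mathbb R^2$ be sites with $\int_{\mathbb R^2}k(s_j,x)\,dx>0$ for $j=1,\dots,d$. Then the random vectors $(Z(s_1),\dots,Z(s_d))$ and $(\tilde Z(s_1),\dots,\tilde Z(s_d))$ have continuous margins and the same stable tail dependence function, namely $$\ell(w_1,\dots,w_d)=\int_{\mathbb R^2}\max_{1\le j\le d} w_j\,\zeta(s_j,x)\,dx,\qquad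 \zeta(s,x)=\frac{k(s,x)}{\int_{\mathbb R^2}k(s,y)\,dy},\qquad w_1,\dots,w_d\ge 0.$$ That is, if $C$ denotes the copula of either vector, then $$\lim_{n\to\infty}C\bigl(u_1^{1/n},\dots,u_d^{1/n}\bigr)^n=\exp\{-\ell(-\log u_1,\dots,-\log u_d)\}\quad\text{for all } u\in(0,1]^d,$$ and $$\lim_{n\to\infty}n\bigl\{1-C(1-w_1/n,\dots,1-w_d/n)\bigr\}=\ell(w_1,\dots,w_d)\quad\text{for all } w\in[0,\infty)^d.$$ -/

import Mathlib

open MeasureTheory ProbabilityTheory Filter Topology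

/-- The plane `ℝ²` with its Euclidean structure, in which the sites live. -/
abbrev Plane : Type := EuclideanSpace ℝ (Fin 2)

/-- `W` is a Cauchy white noise on `ℝ²`: an independently scattered random measure, defined on the
Borel sets of finite Lebesgue measure, such that `W A` has the Cauchy distribution centred at `0`
with scale parameter the area of `A` (density `π⁻¹ c / (z² + c²)`, where `c` is the area of `A`;
the point mass at `0` if `c = 0`). -/
structure IsCauchyWhiteNoise {Ω : Type*} [MeasurableSpace Ω] (μ : Measure Ω)
    (W : Set Plane → Ω → ℝ) : Prop where
  /-- Each `W A` is a random variable. -/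
  measurable : ∀ A : Set Plane, MeasurableSet A → volume A < ⊤ → Measurable (W A)
  /-- `W A` is Cauchy with scale `|A|`. -/
  law : ∀ A : Set Plane, MeasurableSet A → volume A < ⊤ →
    HasLaw (W A) (cauchyMeasure 0 (volume A).toNNReal) μ
  /-- The values on pairwise disjoint sets are (mutually) independent. -/
  indep : ∀ A : ℕ → Set Plane, (∀ i, MeasurableSet (A i)) → (∀ i, volume (A i) < ⊤) →
    Pairwise (fun i j => Disjoint (A i) (A j)) → iIndepFun (fun i => W (A i)) μ
  /-- Almost sure countable additivity. (Almost sure convergence of the partial sums; absolute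
  convergence cannot be asked for.) -/
  additive : ∀ A : ℕ → Set Plane, (∀ i, MeasurableSet (A i)) → volume (⋃ i, A i) < ⊤ →
    Pairwise (fun i j => Disjoint (A i) (A j)) →
    ∀ᵐ ω ∂μ, Tendsto (fun n : ℕ => ∑ i ∈ Finset.range n, W (A i) ω) atTop (𝓝 (W (⋃ i, A i) ω))

/-- The integral `∫ φ dW = ∑_y y W(φ = y)` of a simple function `φ`. -/
noncomputable def simpleNoiseIntegral {Ω : Type*} (W : Set Plane → Ω → ℝ)
    (φ : SimpleFunc Plane ℝ) (ω : Ω) : ℝ :=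
  ∑ y ∈ φ.range, y * W (φ ⁻¹' {y}) ω

/-- The random variable `X` is (a version of) the stochastic integral `∫ f(x) W(dx)` with respect
to the Cauchy white noise `W`: the limit in probability of the integrals of integrable simple
functions that converge to `f` in `L¹`. -/
def IsNoiseIntegral {Ω : Type*} [MeasurableSpace Ω] (μ : Measure Ω) (W : Set Plane → Ω → ℝ)
    (f : Plane → ℝ) (X : Ω → ℝ) : Prop :=
  ∃ φ : ℕ → SimpleFunc Plane ℝ,
    (∀ n, Integrable (φ n) (volume : Measure Plane)) ∧
    Tendsto (fun n => eLpNorm (fun x => φ n x - f x) 1 (volume : Measure Plane)) atTop (𝓝 0) ∧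
    TendstoInMeasure μ (fun n => simpleNoiseIntegral W (φ n)) atTop X

/-- `Z` is the Cauchy process convolution `Z(s) = ∫ k(s, x) W(dx)`, `s ∈ ℝ²`. -/
def IsCauchyConvolution {Ω : Type*} [MeasurableSpace Ω] (μ : Measure Ω) (W : Set Plane → Ω → ℝ)
    (k : Plane → Plane → ℝ) (Z : Plane → Ω → ℝ) : Prop :=
  ∀ s, Measurable (Z s) ∧ IsNoiseIntegral μ W (k s) (Z s)

/-- `G` is a (strictly) stationary Gaussian process on `ℝ²` with `N(0,1)` margins. -/
structure IsStationaryStdGaussian {Ω : Type*} [MeasurableSpace Ω] (μ : Measure Ω)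
    (G : Plane → Ω → ℝ) : Prop where
  gaussian : IsGaussianProcess G μ
  margin : ∀ s, HasLaw (G s) (gaussianReal 0 1) μ
  stationary : ∀ (n : ℕ) (t : Fin n → Plane) (h : Plane),
    IdentDistrib (fun ω (i : Fin n) => G (t i + h) ω) (fun ω (i : Fin n) => G (t i) ω) μ μ

/-- The copula of a random vector `X` with continuous marginal distribution functions
`F₁, …, F_d`: the joint distribution function of `(F₁(X₁), …, F_d(X_d))`. -/
noncomputable def copula {Ω : Type*} [MeasurableSpace Ω] (μ : Measure Ω) {d : ℕ}
    (X : Fin d → Ω → ℝ) (u : Fin d → ℝ) : ℝ :=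
  μ.real {ω | ∀ j, cdf (μ.map (X j)) (X j ω) ≤ u j}

/-- The random vector `X` has continuous margins and (upper) stable tail dependence function `ℓ`
(only the values of `ℓ` on `[0, ∞)^d` are constrained, and these are determined): with `C` the
copula of `X`, `C(u₁^{1/n}, …, u_d^{1/n})^n` converges to the extreme-value copula
`exp(-ℓ(-log u₁, …, -log u_d))`, and `n {1 - C(1 - w₁/n, …, 1 - w_d/n)}` converges to
`ℓ(w₁, …, w_d)`. -/
structure HasStableTailDependenceFunction {Ω : Type*} [MeasurableSpace Ω] (μ : Measure Ω) {d : ℕ}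
    (X : Fin d → Ω → ℝ) (ℓ : (Fin d → ℝ) → ℝ) : Prop where
  aemeasurable : ∀ j, AEMeasurable (X j) μ
  continuous_margin : ∀ j, Continuous (cdf (μ.map (X j)))
  tendsto_extremeValue : ∀ u : Fin d → ℝ, (∀ j, 0 < u j) → (∀ j, u j ≤ 1) →
    Tendsto (fun n : ℕ => copula μ X (fun j => u j ^ (1 / (n : ℝ))) ^ n) atTop
      (𝓝 (Real.exp (-ℓ (fun j => -Real.log (u j)))))
  tendsto_tail : ∀ w : Fin d → ℝ, (∀ j, 0 ≤ w j) →
    Tendsto (fun n : ℕ => (n : ℝ) * (1 - copula μ X (fun j => 1 - w j / (n : ℝ)))) atTop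
      (𝓝 (ℓ w))

/-- The normalized kernel `ζ(s, x) = k(s, x) / ∫ k(s, y) dy`. -/
noncomputable def normalizedKernel (k : Plane → Plane → ℝ) (s x : Plane) : ℝ :=
  k s x / ∫ y, k s y

/-- The function `ℓ(w₁, …, w_d) = ∫ max_j w_j ζ(s_j, x) dx`. -/
noncomputable def movingMaximumTail (k : Plane → Plane → ℝ) {d : ℕ} (s : Fin d → Plane)
    (w : Fin d → ℝ) : ℝ :=
  ∫ x, ⨆ j, w j * normalizedKernel k (s j) x

open scoped NNReal

/-! A Cauchy variable of scale γ exceeds t with probability asymptotic to γ/(πt). If the kernels are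
replaced by the coordinates of one nonnegative simple function Ψ, the vector of integrals is a sum
of independent terms p·W(Ψ = p), each a fixed nonnegative vector times a scalar Cauchy variable.
Such a term has tail functional v ↦ π⁻¹ |Ψ = p| max_j v_j p_j (`HasTail.of_cauchy`). By the
principle of a single big jump (`HasTail.add`), these functionals add up to π⁻¹ ∫ max_j v_j Ψ_j.

Simple functions are dense in L¹. The error Z(s_j) − ∫ Ψ_j dW is itself Cauchy, with scale the L¹
distance of the integrands (`hasLaw_noiseIntegral_sub`), so it is small in weak L¹. The functional
is Lipschitz in L¹, so `HasTail.of_approx` gives Λ(v) = π⁻¹ ∫ max_j v_j k(s_j, x) dx for the vector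
of the Z(s_j). The Gaussian term has finite variance, hence a tail o(1/t), and leaves Λ unchanged.

The j-th margin has tail a_j/t with a_j = Λ(e_j), so exceeding the level 1 − w_j/n amounts
asymptotically to X_j > n a_j/w_j. Therefore n(1 − C) tends to Λ(w_j/a_j), where π cancels. The
extreme-value limit follows from (1 + x_n/n)ⁿ → eˣ for x_n → x. -/

/-! ### Characteristic function and tail of the Cauchy law. -/

theorem integrable_exp_neg_mul_abs {γ : ℝ} (hγ : 0 < γ) :
    Integrable (fun x : ℝ => Real.exp (-γ * |x|)) := by
  rw [← integrableOn_univ, ← Set.Iic_union_Ioi (a := (0 : ℝ))]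
  refine IntegrableOn.union ?_ ?_
  · refine (integrableOn_exp_mul_Iic hγ 0).congr_fun (fun x hx => ?_) measurableSet_Iic
    simp only [Set.mem_Iic] at hx
    simp [abs_of_nonpos hx]
  · refine (integrableOn_exp_mul_Ioi (a := -γ) (by linarith) 0).congr_fun (fun x hx => ?_)
      measurableSet_Ioi
    simp only [Set.mem_Ioi] at hx
    simp [abs_of_pos hx]

theorem integral_cexp_mul_exp_neg_mul_abs {γ : ℝ} (hγ : 0 < γ) (s : ℝ) :
    ∫ x : ℝ, Complex.exp (s * x * Complex.I) * (Real.exp (-γ * |x|) : ℂ) =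
      ((2 * γ / (γ ^ 2 + s ^ 2) : ℝ) : ℂ) := by
  have hint : Integrable
      (fun x : ℝ => Complex.exp (s * x * Complex.I) * (Real.exp (-γ * |x|) : ℂ)) := by
    refine (integrable_exp_neg_mul_abs hγ).ofReal.bdd_mul (c := 1)
      (by fun_prop) (Eventually.of_forall fun x => ?_)
    rw [← Complex.ofReal_mul, Complex.norm_exp_ofReal_mul_I]
  rw [← integral_add_compl (measurableSet_Iic (a := (0 : ℝ))) hint, Set.compl_Iic]
  have h1 : ∫ x in Set.Iic (0 : ℝ), Complex.exp (s * x * Complex.I) *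
      (Real.exp (-γ * |x|) : ℂ) = 1 / (γ + s * Complex.I) := by
    have := integral_exp_mul_complex_Iic (a := γ + s * Complex.I) (by simpa using hγ) 0
    rw [setIntegral_congr_fun (g := fun x : ℝ => Complex.exp ((γ + s * Complex.I) * x))
      measurableSet_Iic, this]
    · simp
    · intro x hx
      simp only [Set.mem_Iic] at hx
      simp only [abs_of_nonpos hx, Complex.ofReal_exp, ← Complex.exp_add]
      congr 1
      push_cast
      ring
  have h2 : ∫ x in Set.Ioi (0 : ℝ), Complex.exp (s * x * Complex.I) *
      (Real.exp (-γ * |x|) : ℂ) = 1 / (γ - s * Complex.I) := by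
    have := integral_exp_mul_complex_Ioi (a := -γ + s * Complex.I) (by simpa using hγ) 0
    rw [setIntegral_congr_fun (g := fun x : ℝ => Complex.exp ((-γ + s * Complex.I) * x))
      measurableSet_Ioi, this]
    · rw [show (γ : ℂ) - s * Complex.I = -(-γ + s * Complex.I) by ring]
      rw [one_div, inv_neg]
      simp [neg_div]
    · intro x hx
      simp only [Set.mem_Ioi] at hx
      simp only [abs_of_pos hx, Complex.ofReal_exp, ← Complex.exp_add]
      congr 1
      push_cast
      ring
  rw [h1, h2]
  have e1 : (γ : ℂ) + s * Complex.I ≠ 0 := fun h => by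
    have := congrArg Complex.re h; simp at this; exact hγ.ne' this
  have e2 : (γ : ℂ) - s * Complex.I ≠ 0 := fun h => by
    have := congrArg Complex.re h; simp at this; exact hγ.ne' this
  have e3 : (γ : ℂ) ^ 2 + (s : ℂ) ^ 2 = (γ + s * Complex.I) * (γ - s * Complex.I) := by
    linear_combination ((s : ℂ) ^ 2) * Complex.I_sq
  push_cast
  rw [e3]
  field_simp
  ring

theorem integrable_two_mul_div_sq_add_sq {γ : ℝ} (hγ : 0 < γ) :
    Integrable (fun x : ℝ => 2 * γ / (γ ^ 2 + x ^ 2)) := by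
  have h := (integrable_cauchyPDFReal 0 (γ := γ.toNNReal)).const_mul (2 * Real.pi)
  refine h.congr (Eventually.of_forall fun x => ?_)
  simp only [cauchyPDFReal_def, Real.coe_toNNReal _ hγ.le, sub_zero]
  have : γ ^ 2 + x ^ 2 ≠ 0 := by positivity
  have : x ^ 2 + γ ^ 2 ≠ 0 := by positivity
  have := Real.pi_ne_zero
  field_simp
  ring

/-- Fourier inversion for exp(-γ|x|), which is continuous and integrable with integrable transform;
the substitution x ↦ 2πx accounts for the normalization of the Fourier transform. -/
theorem integral_cexp_mul_two_mul_div {γ : ℝ} (hγ : 0 < γ) (t : ℝ) :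
    ∫ x : ℝ, Complex.exp (t * x * Complex.I) * ((2 * γ / (γ ^ 2 + x ^ 2) : ℝ) : ℂ) =
      2 * Real.pi * Real.exp (-γ * |t|) := by
  set f : ℝ → ℂ := fun x => (Real.exp (-γ * |x|) : ℂ) with hf
  have hfour : FourierTransform.fourier f =
      fun w : ℝ => ((2 * γ / (γ ^ 2 + (2 * Real.pi * w) ^ 2) : ℝ) : ℂ) := by
    ext w
    rw [Real.fourier_real_eq_integral_exp_smul]
    have := integral_cexp_mul_exp_neg_mul_abs hγ (-2 * Real.pi * w)
    rw [show (2 * Real.pi * w) ^ 2 = (-2 * Real.pi * w) ^ 2 by ring, ← this]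
    refine integral_congr_ae (Eventually.of_forall fun x => ?_)
    simp only [hf, smul_eq_mul]
    congr 3
    push_cast
    ring
  have hpi : (2 * Real.pi) ≠ 0 := by positivity
  have hint : Integrable (FourierTransform.fourier f) := by
    rw [hfour]
    exact ((integrable_two_mul_div_sq_add_sq hγ).comp_mul_left' hpi).ofReal
  have hinv := congrFun (Continuous.fourierInv_fourier_eq (f := f) (by fun_prop)
    (integrable_exp_neg_mul_abs hγ).ofReal hint) t
  rw [Real.fourierInv_eq', hfour] at hinv
  have hsub := Measure.integral_comp_mul_left
    (fun x : ℝ => Complex.exp (t * x * Complex.I) * ((2 * γ / (γ ^ 2 + x ^ 2) : ℝ) : ℂ))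
    (2 * Real.pi)
  have heq : ∫ x : ℝ, Complex.exp (t * ((2 * Real.pi * x : ℝ) : ℂ) * Complex.I) *
      ((2 * γ / (γ ^ 2 + (2 * Real.pi * x) ^ 2) : ℝ) : ℂ) = f t := by
    rw [← hinv]
    refine integral_congr_ae (Eventually.of_forall fun x => ?_)
    simp only [smul_eq_mul]
    congr 2
    simp
    ring
  rw [heq] at hsub
  rw [abs_of_pos (by positivity)] at hsub
  simp only [hf, Complex.real_smul] at hsub
  rw [hsub, ← mul_assoc, ← Complex.ofReal_ofNat, ← Complex.ofReal_mul, ← Complex.ofReal_mul,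
    mul_inv_cancel₀ hpi]
  simp


/-- The scale enters linearly in the exponent, so scales add under independent sums. Scale 0 is
included because level sets may be null. -/
theorem charFun_cauchyMeasure (γ : ℝ≥0) (t : ℝ) :
    charFun (cauchyMeasure 0 γ) t = Real.exp (-γ * |t|) := by
  rw [charFun_apply_real]
  rcases eq_or_ne γ 0 with rfl | hγ
  · simp
  have hγ' : (0 : ℝ) < γ := by positivity
  rw [cauchyMeasure_of_scale_ne_zero 0 hγ]
  have : volume.withDensity (cauchyPDF 0 γ) =
    volume.withDensity (fun x => ((cauchyPDFReal 0 γ x).toNNReal : ENNReal)) := rfl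
  rw [this, integral_withDensity_eq_integral_smul (by fun_prop)]
  have h := integral_cexp_mul_two_mul_div hγ' t
  have hp : (2 * Real.pi : ℂ) ≠ 0 := by simp [Real.pi_ne_zero]
  rw [mul_comm (2 * Real.pi : ℂ), ← div_eq_iff hp] at h
  rw [← h, ← integral_div]
  refine integral_congr_ae (Eventually.of_forall fun x => ?_)
  beta_reduce
  rw [NNReal.smul_def, Real.coe_toNNReal _ (cauchyPDF_pos 0 hγ x).le, Complex.real_smul,
    cauchyPDFReal_def, sub_zero]
  have e1 : (γ : ℝ) ^ 2 + x ^ 2 ≠ 0 := by positivity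
  have e1' : ((γ : ℝ) : ℂ) ^ 2 + (x : ℂ) ^ 2 ≠ 0 := by exact_mod_cast e1
  have e2 : (Real.pi : ℂ) ≠ 0 := by simp [Real.pi_ne_zero]
  push_cast
  rw [add_comm ((x : ℂ) ^ 2)]
  field_simp

theorem cauchyMeasure_absolutelyContinuous {γ : ℝ≥0} (hγ : γ ≠ 0) :
    cauchyMeasure 0 γ ≪ volume := by
  rw [cauchyMeasure_of_scale_ne_zero 0 hγ]
  exact withDensity_absolutelyContinuous _ _

/-- Written with γ/t, the formula also covers γ = 0, and its asymptotics reduce to the derivative of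
arctan at 0. -/
theorem cauchyMeasure_real_Ioi {γ : ℝ≥0} (t : ℝ) (ht : 0 < t) :
    (cauchyMeasure 0 γ).real (Set.Ioi t) = Real.pi⁻¹ * Real.arctan (γ / t) := by
  rcases eq_or_ne γ 0 with rfl | hγ
  · simp [measureReal_def, ht.le]
  have hγ' : (0 : ℝ) < γ := by positivity
  rw [cauchyMeasure_of_scale_ne_zero 0 hγ, measureReal_def,
    withDensity_apply _ measurableSet_Ioi]
  simp only [cauchyPDF]
  rw [← integral_eq_lintegral_of_nonneg_ae
    (Eventually.of_forall fun x => (cauchyPDF_pos 0 hγ x).le) (by fun_prop)]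
  have h1 : ∀ x : ℝ, cauchyPDFReal 0 γ x =
      Real.pi⁻¹ * (γ : ℝ)⁻¹ * (1 + ((γ : ℝ)⁻¹ * x) ^ 2)⁻¹ := fun x => by
    rw [cauchyPDFReal_def', sub_zero, div_eq_inv_mul]; rfl
  simp only [h1]
  rw [integral_const_mul, integral_comp_mul_left_Ioi (fun y : ℝ => (1 + y ^ 2)⁻¹) t
    (inv_pos.2 hγ'), integral_Ioi_inv_one_add_sq, inv_inv, smul_eq_mul]
  rw [show (γ : ℝ) / t = ((γ : ℝ)⁻¹ * t)⁻¹ by field_simp, Real.arctan_inv_of_pos (by positivity)]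
  field_simp

theorem map_neg_cauchyMeasure (γ : ℝ≥0) :
    (cauchyMeasure 0 γ).map (fun x => -x) = cauchyMeasure 0 γ := by
  have : IsProbabilityMeasure ((cauchyMeasure 0 γ).map (fun x : ℝ => -x)) :=
    Measure.isProbabilityMeasure_map (by fun_prop)
  refine Measure.ext_of_charFun ?_
  ext t
  have h := charFun_map_mul (μ := cauchyMeasure 0 γ) (-1) t
  simp only [neg_mul, one_mul] at h
  rw [h, charFun_cauchyMeasure, charFun_cauchyMeasure, abs_neg]

theorem HasDerivAt.tendsto_mul_sub_atTop {f : ℝ → ℝ} {f' : ℝ} (h : HasDerivAt f f' 0) (c : ℝ) :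
    Tendsto (fun t : ℝ => t * (f (c / t) - f 0)) atTop (𝓝 (c * f')) := by
  rcases eq_or_ne c 0 with rfl | hc
  · simp
  have h2 : Tendsto (fun t : ℝ => c / t) atTop (𝓝[≠] 0) := by
    refine tendsto_nhdsWithin_iff.2 ⟨tendsto_const_nhds.div_atTop tendsto_id, ?_⟩
    filter_upwards [eventually_gt_atTop 0] with t ht
    simp [hc, ht.ne']
  refine ((h.tendsto_slope_zero.comp h2).const_mul c).congr fun t => ?_
  simp only [zero_add, Function.comp_apply, smul_eq_mul, inv_div]
  field_simp

theorem tendsto_mul_arctan_div (c : ℝ) :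
    Tendsto (fun t : ℝ => t * Real.arctan (c / t)) atTop (𝓝 c) := by
  simpa using (Real.hasDerivAt_arctan 0).tendsto_mul_sub_atTop c

theorem arctan_le_self {x : ℝ} (hx : 0 ≤ x) : Real.arctan x ≤ x := by
  rcases hx.eq_or_lt with rfl | hx
  · simp
  have := Real.lt_tan (Real.arctan_pos.2 hx) (Real.arctan_lt_pi_div_two x)
  rw [Real.tan_arctan] at this
  exact this.le

/-! ### Tail asymptotics of a single Cauchy variable. -/

section
variable {Ω : Type*} [MeasurableSpace Ω] {μ : Measure Ω} {X : Ω → ℝ} {γ : ℝ≥0}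

theorem ProbabilityTheory.HasLaw.measureReal_lt_cauchy (h : HasLaw X (cauchyMeasure 0 γ) μ) {t : ℝ}
    (ht : 0 < t) : μ.real {ω | t < X ω} = Real.pi⁻¹ * Real.arctan (γ / t) := by
  rw [← cauchyMeasure_real_Ioi t ht, ← h.map_eq,
    map_measureReal_apply_of_aemeasurable h.aemeasurable measurableSet_Ioi]
  rfl

theorem ProbabilityTheory.HasLaw.neg_cauchy (h : HasLaw X (cauchyMeasure 0 γ) μ) :
    HasLaw (fun ω => -X ω) (cauchyMeasure 0 γ) μ :=
  HasLaw.comp (Y := fun x : ℝ => -x) ⟨by fun_prop, map_neg_cauchyMeasure γ⟩ h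

theorem ProbabilityTheory.HasLaw.tendsto_cauchy (h : HasLaw X (cauchyMeasure 0 γ) μ) :
    Tendsto (fun t : ℝ => t * μ.real {ω | t < X ω}) atTop (𝓝 (Real.pi⁻¹ * γ)) := by
  refine ((tendsto_mul_arctan_div γ).const_mul Real.pi⁻¹).congr' ?_
  filter_upwards [eventually_gt_atTop 0] with t ht
  rw [h.measureReal_lt_cauchy ht]
  ring

/-- From arctan x ≤ x and symmetry. The bound is uniform in t and linear in the scale, so L¹
closeness of integrands becomes weak-L¹ closeness of integrals. -/
theorem ProbabilityTheory.HasLaw.mul_measureReal_lt_abs_cauchy_le [IsFiniteMeasure μ]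
    (h : HasLaw X (cauchyMeasure 0 γ) μ) {t : ℝ} (ht : 0 < t) :
    t * μ.real {ω | t < |X ω|} ≤ 2 * γ := by
  have h1 : {ω | t < |X ω|} = {ω | t < X ω} ∪ {ω | t < -X ω} := by
    ext ω; simp [lt_abs]
  have h2 := measureReal_union_le (μ := μ) {ω | t < X ω} {ω | t < -X ω}
  rw [← h1, h.measureReal_lt_cauchy ht, h.neg_cauchy.measureReal_lt_cauchy ht] at h2
  have h3 : Real.arctan (γ / t) ≤ γ / t := arctan_le_self (by positivity)
  have h4 : Real.pi⁻¹ ≤ 1 := inv_le_one_of_one_le₀ (by linarith [Real.pi_gt_three])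
  have h5 : Real.pi⁻¹ * Real.arctan (γ / t) ≤ 1 * (γ / t) :=
    mul_le_mul h4 h3 (Real.arctan_nonneg.2 (by positivity)) zero_le_one
  calc t * μ.real {ω | t < |X ω|} ≤ t * (2 * (γ / t)) := by gcongr; linarith
    _ = 2 * γ := by field_simp

end

theorem abs_iSup_sub_iSup_le {d : ℕ} (a b : Fin d → ℝ) :
    |(⨆ j, a j) - ⨆ j, b j| ≤ ∑ j, |a j - b j| := by
  rcases isEmpty_or_nonempty (Fin d) with hd | hd
  · simp
  have key : ∀ a b : Fin d → ℝ, (⨆ j, a j) ≤ (⨆ j, b j) + ∑ j, |a j - b j| := fun a b => by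
    refine ciSup_le fun j => ?_
    have h1 : b j ≤ ⨆ j, b j := le_ciSup (Set.finite_range b).bddAbove j
    have h2 : |a j - b j| ≤ ∑ j, |a j - b j| :=
      Finset.single_le_sum (f := fun j => |a j - b j|) (fun i _ => abs_nonneg _)
        (Finset.mem_univ j)
    have h3 := le_abs_self (a j - b j)
    linarith
  have h1 := key a b
  have h2 := key b a
  simp only [abs_sub_comm (b _) (a _)] at h2
  rw [abs_le]
  constructor <;> linarith

/-- Squeezing by scaling the threshold. -/
theorem tendsto_of_forall_scaled {α : Type*} {l : Filter α} {f : α → ℝ} {L : ℝ}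
    (hu : ∀ δ, 0 < δ → δ < 1 → ∃ g : α → ℝ, ∃ M, Tendsto g l (𝓝 M) ∧
      M ≤ (1 - δ)⁻¹ * L + δ ∧ ∀ᶠ t in l, f t ≤ g t)
    (hl : ∀ δ, 0 < δ → δ < 1 → ∃ g : α → ℝ, ∃ M, Tendsto g l (𝓝 M) ∧
      (1 + δ)⁻¹ * L - δ ≤ M ∧ ∀ᶠ t in l, g t ≤ f t) :
    Tendsto f l (𝓝 L) := by
  have c1 : Tendsto (fun δ : ℝ => (1 - δ)⁻¹ * L + δ) (𝓝[>] 0) (𝓝 L) := by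
    have : ContinuousAt (fun δ : ℝ => (1 - δ)⁻¹ * L + δ) 0 :=
      ContinuousAt.add (ContinuousAt.mul (ContinuousAt.inv₀ (by fun_prop) (by simp))
        continuousAt_const) continuousAt_id
    simpa using this.tendsto.mono_left (nhdsWithin_le_nhds (s := Set.Ioi 0))
  have c2 : Tendsto (fun δ : ℝ => (1 + δ)⁻¹ * L - δ) (𝓝[>] 0) (𝓝 L) := by
    have : ContinuousAt (fun δ : ℝ => (1 + δ)⁻¹ * L - δ) 0 :=
      ContinuousAt.sub (ContinuousAt.mul (ContinuousAt.inv₀ (by fun_prop) (by simp))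
        continuousAt_const) continuousAt_id
    simpa using this.tendsto.mono_left (nhdsWithin_le_nhds (s := Set.Ioi 0))
  have hev : ∀ᶠ δ : ℝ in 𝓝[>] 0, δ ∈ Set.Ioo (0 : ℝ) 1 := Ioo_mem_nhdsGT one_pos
  refine tendsto_order.2 ⟨fun b hb => ?_, fun b hb => ?_⟩
  · obtain ⟨δ, ⟨h0, h1⟩, h2⟩ := (hev.and (c2.eventually_const_lt hb)).exists
    obtain ⟨g, M, hg, hM, hfg⟩ := hl δ h0 h1
    filter_upwards [hfg, hg.eventually_const_lt (h2.trans_le hM)] with t h3 h4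
    exact h4.trans_le h3
  · obtain ⟨δ, ⟨h0, h1⟩, h2⟩ := (hev.and (c1.eventually_lt_const hb)).exists
    obtain ⟨g, M, hg, hM, hfg⟩ := hu δ h0 h1
    filter_upwards [hfg, hg.eventually_lt_const (hM.trans_lt h2)] with t h3 h4
    exact h3.trans_lt h4

/-! ### Calculus of joint tails of order 1/t. -/

section
variable {Ω : Type*} [MeasurableSpace Ω]

/-- The random vector `X` has upper tail of order `t⁻¹`, with limit functional `Λ`. -/
def HasTail (μ : Measure Ω) {d : ℕ} (X : Fin d → Ω → ℝ) (Λ : (Fin d → ℝ) → ℝ) : Prop :=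
  ∀ v : Fin d → ℝ, (∀ j, 0 ≤ v j) →
    Tendsto (fun t : ℝ => t * μ.real {ω | ∃ j, t < v j * X j ω}) atTop (𝓝 (Λ v))

/-- The tail of `|X|` is at most `K t⁻¹`. -/
def HasWeakBound (μ : Measure Ω) (X : Ω → ℝ) (K : ℝ) : Prop :=
  ∀ t : ℝ, 0 < t → t * μ.real {ω | t < |X ω|} ≤ K

variable {μ : Measure Ω} {d : ℕ}

theorem HasWeakBound.nonneg {X : Ω → ℝ} {K : ℝ} (h : HasWeakBound μ X K) : 0 ≤ K :=
  le_trans (by positivity) (h 1 one_pos)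

theorem HasWeakBound.exists_abs {X : Fin d → Ω → ℝ} {K : Fin d → ℝ}
    (hX : ∀ j, HasWeakBound μ (X j) (K j)) {t : ℝ} (ht : 0 < t) :
    t * μ.real {ω | ∃ j, t < |X j ω|} ≤ ∑ j, K j := by
  have h1 : {ω | ∃ j, t < |X j ω|} = ⋃ j, {ω | t < |X j ω|} := by ext; simp
  rw [h1]
  refine (mul_le_mul_of_nonneg_left (measureReal_iUnion_fintype_le _) ht.le).trans ?_
  rw [Finset.mul_sum]
  exact Finset.sum_le_sum fun j _ => hX j t ht

/-- Rescaling the threshold. -/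
theorem HasTail.tendsto_scaled {X : Fin d → Ω → ℝ} {Λ : (Fin d → ℝ) → ℝ} (h : HasTail μ X Λ)
    {v : Fin d → ℝ} (hv : ∀ j, 0 ≤ v j) {a : ℝ} (ha : 0 < a) :
    Tendsto (fun t : ℝ => t * μ.real {ω | ∃ j, a * t < v j * X j ω}) atTop (𝓝 (a⁻¹ * Λ v)) := by
  refine (((h v hv).comp (tendsto_id.const_mul_atTop ha)).const_mul a⁻¹).congr fun t => ?_
  simp only [Function.comp_apply, id_eq]
  field_simp

theorem HasWeakBound.const_mul {X : Ω → ℝ} {K : ℝ} (hX : HasWeakBound μ X K) {c : ℝ}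
    (hc : 0 ≤ c) : HasWeakBound μ (fun ω => c * X ω) (c * K) := by
  intro t ht
  rcases hc.eq_or_lt with rfl | hc
  · simp [not_lt.2 ht.le]
  have h1 : {ω | t < |c * X ω|} = {ω | t / c < |X ω|} := by
    ext ω
    simp [abs_mul, abs_of_pos hc, div_lt_iff₀' hc]
  rw [h1]
  have h2 := mul_le_mul_of_nonneg_left (hX (t / c) (by positivity)) hc.le
  rwa [← mul_assoc, mul_div_cancel₀ _ hc.ne'] at h2

theorem HasTail.zero : HasTail μ (fun (_ : Fin d) (_ : Ω) => (0 : ℝ)) (fun _ => 0) := by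
  intro v hv
  refine tendsto_const_nhds.congr' ?_
  filter_upwards [eventually_gt_atTop 0] with t ht
  simp [not_lt.2 ht.le]

theorem HasTail.congr_ae {X Y : Fin d → Ω → ℝ} {Λ : (Fin d → ℝ) → ℝ} (h : HasTail μ X Λ)
    (hXY : ∀ j, X j =ᵐ[μ] Y j) : HasTail μ Y Λ := by
  intro v hv
  refine (h v hv).congr fun t => ?_
  congr 1
  refine measureReal_congr ?_
  rw [eventuallyEq_set]
  filter_upwards [ae_all_iff.2 hXY] with ω hω
  simp only [hω]

/-- A Cauchy variable times a nonnegative vector. -/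
theorem HasTail.of_cauchy {V : Ω → ℝ} {γ : ℝ≥0} (h : HasLaw V (cauchyMeasure 0 γ) μ)
    {b : Fin d → ℝ} (hb : ∀ j, 0 ≤ b j) :
    HasTail μ (fun j ω => b j * V ω) (fun v => Real.pi⁻¹ * (γ * ⨆ j, v j * b j)) := by
  intro v hv
  set m : ℝ := ⨆ j, v j * b j with hm
  have hm0 : 0 ≤ m := Real.iSup_nonneg fun j => mul_nonneg (hv j) (hb j)
  have hle : ∀ j, v j * b j ≤ m := fun j => le_ciSup
    (f := fun j => v j * b j) (Set.finite_range _).bddAbove j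
  have hset : ∀ t : ℝ, 0 < t → {ω | ∃ j, t < v j * (b j * V ω)} = {ω | t < m * V ω} := by
    intro t ht
    ext ω
    simp only [Set.mem_ofPred_eq, ← mul_assoc]
    constructor
    · rintro ⟨j, hj⟩
      -- All coefficients are nonnegative and t > 0, so an exceedance forces V > 0, and the largest
      -- coefficient then dominates.
      have hV : 0 < V ω := by
        by_contra! hV
        linarith [mul_nonpos_of_nonneg_of_nonpos (mul_nonneg (hv j) (hb j)) hV]
      exact hj.trans_le (mul_le_mul_of_nonneg_right (hle j) hV.le)
    · intro hω
      rcases isEmpty_or_nonempty (Fin d) with hd | hd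
      · rw [hm, Real.iSup_of_isEmpty] at hω
        linarith
      · obtain ⟨j, hj⟩ := exists_eq_ciSup_of_finite (f := fun j => v j * b j)
        exact ⟨j, by rw [hj]; exact hω⟩
  rcases hm0.eq_or_lt with h0 | h0
  · beta_reduce
    rw [← hm, ← h0]
    simp only [mul_zero]
    refine tendsto_const_nhds.congr' ?_
    filter_upwards [eventually_gt_atTop 0] with t ht
    rw [hset t ht, ← h0]
    simp [not_lt.2 ht.le]
  · have h1 := (h.tendsto_cauchy.comp
      (tendsto_id.const_mul_atTop (inv_pos.2 h0))).const_mul m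
    have : m * (Real.pi⁻¹ * γ) = Real.pi⁻¹ * (γ * m) := by ring
    rw [this] at h1
    refine h1.congr' ?_
    filter_upwards [eventually_gt_atTop 0] with t ht
    have h2 : {ω | t < m * V ω} = {ω | m⁻¹ * t < V ω} := by
      ext ω
      simp only [Set.mem_ofPred_eq]
      rw [inv_mul_lt_iff₀ h0]
    rw [hset t ht, h2]
    simp only [Function.comp_apply, id_eq]
    field_simp

variable [IsFiniteMeasure μ]

/-- One summand must exceed half the threshold, whence the factor 2. Only the finiteness of the
bound matters for sums. -/
theorem HasWeakBound.add {X Y : Ω → ℝ} {K L : ℝ} (hX : HasWeakBound μ X K)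
    (hY : HasWeakBound μ Y L) : HasWeakBound μ (fun ω => X ω + Y ω) (2 * (K + L)) := by
  intro t ht
  have h1 : {ω | t < |X ω + Y ω|} ⊆ {ω | t / 2 < |X ω|} ∪ {ω | t / 2 < |Y ω|} := by
    intro ω hω
    simp only [Set.mem_ofPred_eq, Set.mem_union] at hω ⊢
    by_contra! h
    linarith [abs_add_le (X ω) (Y ω), h.1, h.2]
  have h2 := (measureReal_mono (μ := μ) h1).trans (measureReal_union_le _ _)
  have h3 := hX (t / 2) (by positivity)
  have h4 := hY (t / 2) (by positivity)
  have h5 := mul_le_mul_of_nonneg_left h2 ht.le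
  linarith

/-- The principle of a single big jump for two independent random vectors. -/
theorem HasTail.add {X Y : Fin d → Ω → ℝ} {Λ Λ' : (Fin d → ℝ) → ℝ} {K K' : Fin d → ℝ}
    (hX : HasTail μ X Λ) (hY : HasTail μ Y Λ')
    (hKX : ∀ j, HasWeakBound μ (X j) (K j)) (hKY : ∀ j, HasWeakBound μ (Y j) (K' j))
    (hXm : ∀ j, Measurable (X j)) (hYm : ∀ j, Measurable (Y j))
    (hind : IndepFun (fun ω j => X j ω) (fun ω j => Y j ω) μ) :
    HasTail μ (fun j ω => X j ω + Y j ω) (fun v => Λ v + Λ' v) := by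
  intro v hv
  -- both vectors are large
  have hpair : ∀ δ, 0 < δ → Tendsto (fun t : ℝ => t * μ.real ({ω | ∃ j, δ * t < |v j * X j ω|} ∩
      {ω | ∃ j, δ * t < |v j * Y j ω|})) atTop (𝓝 0) := by
    intro δ hδ
    set A : ℝ := ∑ j, v j * K j
    set B : ℝ := ∑ j, v j * K' j
    have hA : 0 ≤ A := Finset.sum_nonneg fun j _ => mul_nonneg (hv j) (hKX j).nonneg
    have hlim : Tendsto (fun t : ℝ => A * B / δ ^ 2 / t) atTop (𝓝 0) :=
      tendsto_const_nhds.div_atTop tendsto_id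
    refine squeeze_zero' ?_ ?_ hlim
    · filter_upwards [eventually_ge_atTop 0] with t ht
      positivity
    · filter_upwards [eventually_gt_atTop 0] with t ht
      have hms : MeasurableSet {x : Fin d → ℝ | ∃ j, δ * t < |v j * x j|} := by
        rw [Set.ofPred_exists]
        exact MeasurableSet.iUnion fun j => measurableSet_lt measurable_const (by fun_prop)
      -- Independence turns the joint probability into a product of two factors O(1/t), so t times
      -- it is still O(1/t).
      have hi := hind.measure_inter_preimage_eq_mul _ _ hms hms
      have hi' : μ.real ({ω | ∃ j, δ * t < |v j * X j ω|} ∩ {ω | ∃ j, δ * t < |v j * Y j ω|}) =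
          μ.real {ω | ∃ j, δ * t < |v j * X j ω|} * μ.real {ω | ∃ j, δ * t < |v j * Y j ω|} := by
        simp only [measureReal_def, ← ENNReal.toReal_mul]
        exact congrArg _ hi
      have h1 := HasWeakBound.exists_abs (fun j => (hKX j).const_mul (hv j))
        (t := δ * t) (by positivity)
      have h2 := HasWeakBound.exists_abs (fun j => (hKY j).const_mul (hv j))
        (t := δ * t) (by positivity)
      rw [hi']
      have h3 := mul_le_mul h1 h2 (by positivity) hA
      rw [le_div_iff₀ ht, le_div_iff₀ (by positivity)]
      linarith
  have hXms : ∀ c, MeasurableSet {ω | ∃ j, c < v j * X j ω} := fun c => by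
    rw [Set.ofPred_exists]
    exact MeasurableSet.iUnion fun j => measurableSet_lt measurable_const ((hXm j).const_mul _)
  have hYms : ∀ c, MeasurableSet {ω | ∃ j, c < v j * Y j ω} := fun c => by
    rw [Set.ofPred_exists]
    exact MeasurableSet.iUnion fun j => measurableSet_lt measurable_const ((hYm j).const_mul _)
  refine tendsto_of_forall_scaled (fun δ h0 h1 => ?_) (fun δ h0 h1 => ?_)
  · refine ⟨_, _, ((hX.tendsto_scaled hv (sub_pos.2 h1)).add
      (hY.tendsto_scaled hv (sub_pos.2 h1))).add (hpair δ h0), by linarith, ?_⟩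
    filter_upwards [eventually_gt_atTop 0] with t ht
    -- If the sum exceeds t while neither term exceeds (1 - δ)t, then both exceed δt.
    have hsub : {ω | ∃ j, t < v j * (X j ω + Y j ω)} ⊆
        ({ω | ∃ j, (1 - δ) * t < v j * X j ω} ∪ {ω | ∃ j, (1 - δ) * t < v j * Y j ω}) ∪
        ({ω | ∃ j, δ * t < |v j * X j ω|} ∩ {ω | ∃ j, δ * t < |v j * Y j ω|}) := by
      rintro ω ⟨j, hj⟩
      by_cases hx : (1 - δ) * t < v j * X j ω
      · exact Or.inl (Or.inl ⟨j, hx⟩)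
      by_cases hy : (1 - δ) * t < v j * Y j ω
      · exact Or.inl (Or.inr ⟨j, hy⟩)
      refine Or.inr ⟨⟨j, lt_of_lt_of_le ?_ (le_abs_self _)⟩,
        ⟨j, lt_of_lt_of_le ?_ (le_abs_self _)⟩⟩ <;> linarith
    rw [← mul_add, ← mul_add]
    refine mul_le_mul_of_nonneg_left ?_ ht.le
    refine (measureReal_mono hsub).trans ((measureReal_union_le _ _).trans ?_)
    gcongr
    exact measureReal_union_le _ _
  · have hδ : 0 < 1 + δ := by linarith
    refine ⟨_, _, ((hX.tendsto_scaled hv hδ).add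
      (hY.tendsto_scaled hv hδ)).sub ((hpair δ h0).const_mul 2), by linarith, ?_⟩
    filter_upwards [eventually_gt_atTop 0] with t ht
    set A := {ω | ∃ j, (1 + δ) * t < v j * X j ω}
    set B := {ω | ∃ j, (1 + δ) * t < v j * Y j ω}
    set P := {ω | ∃ j, δ * t < |v j * X j ω|} ∩ {ω | ∃ j, δ * t < |v j * Y j ω|}
    have hδt : 0 < δ * t := by positivity
    -- A term above (1 + δ)t can only be cancelled by another below -δt; hence the absolute values
    -- in `P`.
    have hsub : A ∪ B ⊆ {ω | ∃ j, t < v j * (X j ω + Y j ω)} ∪ P := by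
      rintro ω (⟨j, hj⟩ | ⟨j, hj⟩)
      · by_cases hy : -(δ * t) ≤ v j * Y j ω
        · exact Or.inl ⟨j, by linarith⟩
        · refine Or.inr ⟨⟨j, lt_of_lt_of_le ?_ (le_abs_self _)⟩,
            ⟨j, lt_of_lt_of_le ?_ (neg_le_abs _)⟩⟩ <;> linarith
      · by_cases hy : -(δ * t) ≤ v j * X j ω
        · exact Or.inl ⟨j, by linarith⟩
        · refine Or.inr ⟨⟨j, lt_of_lt_of_le ?_ (neg_le_abs _)⟩,
            ⟨j, lt_of_lt_of_le ?_ (le_abs_self _)⟩⟩ <;> linarith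
    have hAB : A ∩ B ⊆ P := by
      rintro ω ⟨⟨i, hi⟩, ⟨j, hj⟩⟩
      refine ⟨⟨i, lt_of_lt_of_le ?_ (le_abs_self _)⟩,
            ⟨j, lt_of_lt_of_le ?_ (le_abs_self _)⟩⟩ <;> linarith
    -- Inclusion-exclusion costs `P` twice: once for cancellation in `A ∪ B`, once for `A ∩ B`.
    have e1 := measureReal_union_add_inter (μ := μ) (s := A) (hYms ((1 + δ) * t))
    have e2 := (measureReal_mono (μ := μ) hsub).trans (measureReal_union_le _ _)
    have e3 := measureReal_mono (μ := μ) hAB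
    have : t * μ.real A + t * μ.real B - 2 * (t * μ.real P) =
      t * (μ.real A + μ.real B - 2 * μ.real P) := by ring
    rw [this]
    refine mul_le_mul_of_nonneg_left ?_ ht.le
    change μ.real (A ∪ B) + μ.real (A ∩ B) = μ.real A + μ.real B at e1
    linarith

theorem HasTail.sum {ι : Type*} {X : ι → Fin d → Ω → ℝ} {Λ : ι → (Fin d → ℝ) → ℝ}
    {K : ι → Fin d → ℝ} (s : Finset ι) (hX : ∀ i, HasTail μ (X i) (Λ i))
    (hK : ∀ i j, HasWeakBound μ (X i j) (K i j)) (hm : ∀ i j, Measurable (X i j))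
    (hind : iIndepFun (fun i ω j => X i j ω) μ) :
    HasTail μ (fun j ω => ∑ i ∈ s, X i j ω) (fun v => ∑ i ∈ s, Λ i v) := by
  classical
  -- The induction must also carry weak bounds for the partial sums, as `HasTail.add` requires them.
  suffices h : HasTail μ (fun j ω => ∑ i ∈ s, X i j ω) (fun v => ∑ i ∈ s, Λ i v) ∧
      ∀ j, ∃ L, HasWeakBound μ (fun ω => ∑ i ∈ s, X i j ω) L from h.1
  induction s using Finset.induction_on with
  | empty => exact ⟨by simpa using HasTail.zero, fun j => ⟨0, fun t ht => by simp [not_lt.2 ht.le]⟩⟩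
  | insert i s hi ih =>
    obtain ⟨h1, h2⟩ := ih
    choose L hL using h2
    simp only [Finset.sum_insert hi]
    refine ⟨(hX i).add h1 (hK i) hL (hm i)
      (fun j => Finset.measurable_fun_sum _ fun i _ => hm i j) ?_,
      fun j => ⟨_, (hK i j).add (hL j)⟩⟩
    have h3 := (hind.indepFun_finsetSum_of_notMem
      (fun i => measurable_pi_lambda _ fun j => hm i j) hi).symm
    convert h3 using 2 with ω
    ext j
    simp [Finset.sum_apply]

/-- The tail functional is stable under perturbations which are small in weak `L¹`. -/
theorem HasTail.of_approx {X : Fin d → Ω → ℝ} {Λ : (Fin d → ℝ) → ℝ}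
    (h : ∀ η : ℝ, 0 < η → ∃ (Y : Fin d → Ω → ℝ) (Λ' : (Fin d → ℝ) → ℝ), HasTail μ Y Λ' ∧
      (∀ v, (∀ j, 0 ≤ v j) → |Λ' v - Λ v| ≤ η * ∑ j, v j) ∧
      ∀ j, ∀ᶠ t in atTop, t * μ.real {ω | t < |X j ω - Y j ω|} ≤ η) :
    HasTail μ X Λ := by
  intro v hv
  set S : ℝ := ∑ j, v j with hS
  have hS0 : 0 ≤ S := Finset.sum_nonneg fun j _ => hv j
  -- the remainder, at threshold `δ * t`
  have hrem : ∀ (Y : Fin d → Ω → ℝ) (η δ : ℝ), 0 < η → 0 < δ →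
      (∀ j, ∀ᶠ t in atTop, t * μ.real {ω | t < |X j ω - Y j ω|} ≤ η) →
      ∀ᶠ t in atTop, t * μ.real {ω | ∃ j, δ * t < v j * |X j ω - Y j ω|} ≤ δ⁻¹ * (S * η) := by
    intro Y η δ hη hδ hY
    have hj : ∀ j, ∀ᶠ t in atTop, t * μ.real {ω | δ * t < v j * |X j ω - Y j ω|} ≤
        δ⁻¹ * (v j * η) := by
      intro j
      rcases (hv j).eq_or_lt with h0 | h0
      · filter_upwards [eventually_gt_atTop 0] with t ht
        have : 0 ≤ δ * t := by positivity
        simp [← h0, not_lt.2 this]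
      · have hs : Tendsto (fun t : ℝ => δ / v j * t) atTop atTop :=
          tendsto_id.const_mul_atTop (by positivity)
        filter_upwards [hs.eventually (hY j)] with t ht
        have : {ω | δ * t < v j * |X j ω - Y j ω|} = {ω | δ / v j * t < |X j ω - Y j ω|} := by
          ext ω
          simp only [Set.mem_ofPred_eq]
          rw [div_mul_eq_mul_div, div_lt_iff₀' h0]
        rw [this]
        have h3 := mul_le_mul_of_nonneg_left ht (by positivity : 0 ≤ v j / δ)
        calc _ = v j / δ * (δ / v j * t * μ.real {ω | δ / v j * t < |X j ω - Y j ω|}) := by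
              field_simp
          _ ≤ _ := h3
          _ = _ := by field_simp
    filter_upwards [eventually_all.2 hj, eventually_gt_atTop 0] with t h1 ht
    have h2 : {ω | ∃ j, δ * t < v j * |X j ω - Y j ω|} =
        ⋃ j, {ω | δ * t < v j * |X j ω - Y j ω|} := by ext; simp
    rw [h2]
    refine (mul_le_mul_of_nonneg_left (measureReal_iUnion_fintype_le _) ht.le).trans ?_
    rw [Finset.mul_sum, hS, Finset.sum_mul, Finset.mul_sum]
    exact Finset.sum_le_sum fun j _ => h1 j
  refine tendsto_of_forall_scaled (fun δ h0 h1 => ?_) (fun δ h0 h1 => ?_)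
  · have hδ : 0 < 1 - δ := sub_pos.2 h1
    -- Chosen so that the error in the functional and the remainder at threshold δt together cost at
    -- most δ; `S + 1` avoids division by zero.
    set η : ℝ := δ / (((1 - δ)⁻¹ + δ⁻¹) * (S + 1)) with hη
    have hη0 : 0 < η := by positivity
    have hη1 : ((1 - δ)⁻¹ + δ⁻¹) * (S * η) ≤ δ := by
      calc _ ≤ ((1 - δ)⁻¹ + δ⁻¹) * ((S + 1) * η) := by gcongr; linarith
        _ = δ := by rw [hη]; field_simp
    obtain ⟨Y, Λ', hY, hΛ, hXY⟩ := h η hη0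
    refine ⟨_, _, (hY.tendsto_scaled hv hδ).add_const (δ⁻¹ * (S * η)), ?_, ?_⟩
    · have h3 := (abs_le.1 (hΛ v hv)).2
      have h4 : (1 - δ)⁻¹ * Λ' v ≤ (1 - δ)⁻¹ * (Λ v + S * η) := by
        gcongr; linarith
      linarith
    · filter_upwards [hrem Y η δ hη0 h0 hXY, eventually_gt_atTop 0] with t h3 ht
      have hsub : {ω | ∃ j, t < v j * X j ω} ⊆ {ω | ∃ j, (1 - δ) * t < v j * Y j ω} ∪
          {ω | ∃ j, δ * t < v j * |X j ω - Y j ω|} := by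
        rintro ω ⟨j, hj⟩
        by_cases hy : (1 - δ) * t < v j * Y j ω
        · exact Or.inl ⟨j, hy⟩
        · refine Or.inr ⟨j, ?_⟩
          have := mul_le_mul_of_nonneg_left (le_abs_self (X j ω - Y j ω)) (hv j)
          linarith
      have h4 := mul_le_mul_of_nonneg_left
        ((measureReal_mono (μ := μ) hsub).trans (measureReal_union_le _ _)) ht.le
      rw [mul_add] at h4
      linarith
  · have hδ : 0 < 1 + δ := by linarith
    set η : ℝ := δ / (((1 + δ)⁻¹ + δ⁻¹) * (S + 1)) with hη
    have hη0 : 0 < η := by positivity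
    have hη1 : ((1 + δ)⁻¹ + δ⁻¹) * (S * η) ≤ δ := by
      calc _ ≤ ((1 + δ)⁻¹ + δ⁻¹) * ((S + 1) * η) := by gcongr; linarith
        _ = δ := by rw [hη]; field_simp
    obtain ⟨Y, Λ', hY, hΛ, hXY⟩ := h η hη0
    refine ⟨_, _, (hY.tendsto_scaled hv hδ).sub_const (δ⁻¹ * (S * η)), ?_, ?_⟩
    · have h3 := (abs_le.1 (hΛ v hv)).1
      have h4 : (1 + δ)⁻¹ * (Λ v - S * η) ≤ (1 + δ)⁻¹ * Λ' v := by
        gcongr; linarith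
      linarith
    · filter_upwards [hrem Y η δ hη0 h0 hXY, eventually_gt_atTop 0] with t h3 ht
      have hsub : {ω | ∃ j, (1 + δ) * t < v j * Y j ω} ⊆ {ω | ∃ j, t < v j * X j ω} ∪
          {ω | ∃ j, δ * t < v j * |X j ω - Y j ω|} := by
        rintro ω ⟨j, hj⟩
        by_cases hy : t < v j * X j ω
        · exact Or.inl ⟨j, hy⟩
        · refine Or.inr ⟨j, ?_⟩
          have := mul_le_mul_of_nonneg_left (neg_le_abs (X j ω - Y j ω)) (hv j)
          linarith
      have h4 := mul_le_mul_of_nonneg_left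
        ((measureReal_mono (μ := μ) hsub).trans (measureReal_union_le _ _)) ht.le
      rw [mul_add] at h4
      linarith

end

/-! ### From joint tails to the copula. -/

section
variable {Ω : Type*} [MeasurableSpace Ω] {μ : Measure Ω} {d : ℕ}

theorem HasTail.margin {X : Fin d → Ω → ℝ} {Λ : (Fin d → ℝ) → ℝ} (h : HasTail μ X Λ)
    (j : Fin d) :
    Tendsto (fun t : ℝ => t * μ.real {ω | t < X j ω}) atTop (𝓝 (Λ (Pi.single j 1))) := by
  refine (h (Pi.single j 1) fun i => ?_).congr' ?_
  · by_cases hi : i = j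
    · subst hi; simp
    · simp [hi]
  · filter_upwards [eventually_gt_atTop 0] with t ht
    congr 2
    ext ω
    simp only [Set.mem_ofPred_eq]
    refine ⟨fun ⟨i, hi⟩ => ?_, fun hω => ⟨j, by simpa using hω⟩⟩
    by_cases hij : i = j
    · subst hij; simpa using hi
    · simp only [Pi.single_eq_of_ne hij, zero_mul] at hi
      linarith

variable [IsProbabilityMeasure μ]

theorem one_sub_cdf_map {X : Ω → ℝ} (hX : AEMeasurable X μ) (x : ℝ) :
    1 - cdf (μ.map X) x = μ.real {ω | x < X ω} := by
  have := Measure.isProbabilityMeasure_map hX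
  rw [cdf_eq_real, ← probReal_compl_eq_one_sub measurableSet_Iic, Set.compl_Iic,
    map_measureReal_apply_of_aemeasurable hX measurableSet_Ioi]
  rfl

theorem one_sub_copula {X : Fin d → Ω → ℝ} (hX : ∀ j, AEMeasurable (X j) μ) (u : Fin d → ℝ) :
    1 - copula μ X u = μ.real {ω | ∃ j, u j < cdf (μ.map (X j)) (X j ω)} := by
  have hm : NullMeasurableSet {ω | ∀ j, cdf (μ.map (X j)) (X j ω) ≤ u j} μ := by
    rw [Set.ofPred_forall]
    refine NullMeasurableSet.iInter fun j => nullMeasurableSet_le ?_ aemeasurable_const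
    exact (monotone_cdf _).measurable.comp_aemeasurable (hX j)
  have h : {ω | ∃ j, u j < cdf (μ.map (X j)) (X j ω)} =
      {ω | ∀ j, cdf (μ.map (X j)) (X j ω) ≤ u j}ᶜ := by
    ext ω; simp
  rw [h, probReal_compl_eq_one_sub₀ hm, copula]

/-- Since 1 - F_j(c n a_j/w_j) ~ w_j/(cn), the level `u n j` eventually lies between the values of
F_j at c = 1 - δ and c = 1 + δ. Monotonicity of F_j then sandwiches the exceedance event, without
quantile functions. A coordinate with w_j = 0 would have an infinite threshold, so it is kept at
level exactly 1, which F_j never exceeds. -/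
theorem HasTail.tendsto_mul_one_sub_copula {X : Fin d → Ω → ℝ} {Λ : (Fin d → ℝ) → ℝ}
    (h : HasTail μ X Λ) (hX : ∀ j, AEMeasurable (X j) μ) {a : Fin d → ℝ} (ha : ∀ j, 0 < a j)
    (hmarg : ∀ j, Tendsto (fun t : ℝ => t * μ.real {ω | t < X j ω}) atTop (𝓝 (a j)))
    {u : ℕ → Fin d → ℝ} {w : Fin d → ℝ}
    (hu : ∀ j, (w j = 0 ∧ ∀ n, u n j = 1) ∨
      (0 < w j ∧ Tendsto (fun n : ℕ => n * (1 - u n j)) atTop (𝓝 (w j)))) :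
    Tendsto (fun n : ℕ => n * (1 - copula μ X (u n))) atTop (𝓝 (Λ fun j => w j / a j)) := by
  simp only [one_sub_copula hX]
  have hw : ∀ j, 0 ≤ w j := fun j => by
    rcases hu j with ⟨h, -⟩ | ⟨h, -⟩
    exacts [h.ge, h.le]
  have hv : ∀ j, 0 ≤ w j / a j := fun j => div_nonneg (hw j) (ha j).le
  -- the marginal tail at the rescaled threshold
  have hF : ∀ (c : ℝ) (j : Fin d), 0 < c → 0 < w j → Tendsto (fun n : ℕ =>
      (n : ℝ) * (1 - cdf (μ.map (X j)) (c * n * (a j / w j)))) atTop (𝓝 (c⁻¹ * w j)) := by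
    intro c j hc hwj
    have haj := ha j
    have hcw : 0 < c * (a j / w j) := by positivity
    have h1 := ((hmarg j).comp ((tendsto_natCast_atTop_atTop (R := ℝ)).const_mul_atTop
      hcw)).const_mul (c * (a j / w j))⁻¹
    have h2 : (c * (a j / w j))⁻¹ * a j = c⁻¹ * w j := by field_simp
    rw [h2] at h1
    refine h1.congr fun n => ?_
    rw [one_sub_cdf_map (hX j)]
    simp only [Function.comp_apply]
    rw [show c * n * (a j / w j) = c * (a j / w j) * n by ring]
    field_simp
  refine tendsto_of_forall_scaled (fun δ h0 h1 => ?_) (fun δ h0 h1 => ?_)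
  · have hδ : 0 < 1 - δ := sub_pos.2 h1
    refine ⟨_, _, (h.tendsto_scaled hv hδ).comp (tendsto_natCast_atTop_atTop (R := ℝ)),
      by linarith, ?_⟩
    have hev : ∀ j, ∀ᶠ n : ℕ in atTop, 0 < w j →
        cdf (μ.map (X j)) ((1 - δ) * n * (a j / w j)) < u n j := by
      intro j
      rcases hu j with ⟨h2, -⟩ | ⟨h2, h3⟩
      · exact Eventually.of_forall fun n h4 => absurd h2 h4.ne'
      have h4 : w j < (1 - δ)⁻¹ * w j :=
        lt_mul_of_one_lt_left h2 ((one_lt_inv₀ hδ).2 (by linarith))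
      filter_upwards [h3.eventually_lt (hF (1 - δ) j hδ h2) h4, eventually_gt_atTop 0]
        with n h5 hn _
      have hn' : (0 : ℝ) < n := by exact_mod_cast hn
      have := lt_of_mul_lt_mul_left h5 hn'.le
      linarith
    filter_upwards [eventually_all.2 hev] with n hn
    refine mul_le_mul_of_nonneg_left (measureReal_mono ?_) (Nat.cast_nonneg n)
    rintro ω ⟨j, hj⟩
    refine ⟨j, ?_⟩
    rcases hu j with ⟨-, h3⟩ | ⟨h2, -⟩
    · rw [h3] at hj
      exact absurd (cdf_le_one _ _) (not_le.2 hj)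
    · have h3 := (monotone_cdf _).reflect_lt ((hn j h2).trans hj)
      have haj := ha j
      rw [← div_lt_iff₀' (by positivity)]
      refine lt_of_eq_of_lt ?_ h3
      field_simp
  · have hδ : 0 < 1 + δ := by linarith
    refine ⟨_, _, (h.tendsto_scaled hv hδ).comp (tendsto_natCast_atTop_atTop (R := ℝ)),
      by linarith, ?_⟩
    have hev : ∀ j, ∀ᶠ n : ℕ in atTop, 0 < w j →
        u n j < cdf (μ.map (X j)) ((1 + δ) * n * (a j / w j)) := by
      intro j
      rcases hu j with ⟨h2, -⟩ | ⟨h2, h3⟩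
      · exact Eventually.of_forall fun n h4 => absurd h2 h4.ne'
      have h4 : (1 + δ)⁻¹ * w j < w j :=
        mul_lt_of_lt_one_left h2 (inv_lt_one_of_one_lt₀ (by linarith))
      filter_upwards [(hF (1 + δ) j hδ h2).eventually_lt h3 h4, eventually_gt_atTop 0]
        with n h5 hn _
      have hn' : (0 : ℝ) < n := by exact_mod_cast hn
      have := lt_of_mul_lt_mul_left h5 hn'.le
      linarith
    filter_upwards [eventually_all.2 hev] with n hn
    refine mul_le_mul_of_nonneg_left (measureReal_mono ?_) (Nat.cast_nonneg n)
    rintro ω ⟨j, hj⟩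
    refine ⟨j, ?_⟩
    rcases (hw j).eq_or_lt with h2 | h2
    · rw [← h2] at hj
      simp only [zero_div, zero_mul] at hj
      exact absurd hj (not_lt.2 (by positivity))
    · refine (hn j h2).trans_le (monotone_cdf _ ?_)
      have haj := ha j
      rw [← div_lt_iff₀' (by positivity)] at hj
      refine le_trans (le_of_eq ?_) hj.le
      field_simp

theorem HasTail.hasStableTailDependenceFunction {X : Fin d → Ω → ℝ} {Λ : (Fin d → ℝ) → ℝ}
    (h : HasTail μ X Λ) (hX : ∀ j, AEMeasurable (X j) μ)
    (hcont : ∀ j, Continuous (cdf (μ.map (X j)))) (hΛ : ∀ j, 0 < Λ (Pi.single j 1)) :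
    HasStableTailDependenceFunction μ X (fun w => Λ fun j => w j / Λ (Pi.single j 1)) where
  aemeasurable := hX
  continuous_margin := hcont
  tendsto_extremeValue u hu0 hu1 := by
    have key := h.tendsto_mul_one_sub_copula hX hΛ h.margin
      (u := fun n j => u j ^ (1 / (n : ℝ))) (w := fun j => -Real.log (u j)) fun j => ?_
    -- C = 1 + (C - 1), where n(C - 1) converges to minus the limit functional.
    · have := Real.tendsto_one_add_pow_exp_of_tendsto
        (g := fun n => copula μ X (fun j => u j ^ (1 / (n : ℝ))) - 1) (key.neg.congr fun n => by ring)
      simpa using this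
    · rcases (hu1 j).eq_or_lt with h1 | h1
      · exact Or.inl ⟨by simp [h1], fun n => by simp [h1]⟩
      · refine Or.inr ⟨neg_pos.2 (Real.log_neg (hu0 j) h1), ?_⟩
        have h2 := (((Real.hasDerivAt_exp 0).tendsto_mul_sub_atTop (Real.log (u j))).comp
          (tendsto_natCast_atTop_atTop (R := ℝ))).neg
        simp only [Real.exp_zero, mul_one] at h2
        refine h2.congr fun n => ?_
        simp only [Function.comp_apply]
        rw [Real.rpow_def_of_pos (hu0 j), mul_one_div]
        ring
  tendsto_tail w hw := by
    refine h.tendsto_mul_one_sub_copula hX hΛ h.margin fun j => ?_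
    rcases (hw j).eq_or_lt with h1 | h1
    · exact Or.inl ⟨h1.symm, fun n => by simp [← h1]⟩
    · refine Or.inr ⟨h1, tendsto_const_nhds.congr' ?_⟩
      filter_upwards [eventually_gt_atTop 0] with n hn
      have hn' : (n : ℝ) ≠ 0 := by exact_mod_cast hn.ne'
      field_simp
      ring

/-- The jump of the distribution function at a point is the mass of that point, here zero. -/
theorem continuous_cdf_of_absolutelyContinuous {ν : Measure ℝ} [IsProbabilityMeasure ν]
    (hν : ν ≪ volume) : Continuous (cdf ν) := by
  refine continuous_iff_continuousAt.2 fun x => ?_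
  have h1 : (cdf ν).measure {x} = 0 := by
    rw [measure_cdf]
    exact hν (by simp)
  rw [StieltjesFunction.measure_singleton, ENNReal.ofReal_eq_zero, sub_nonpos] at h1
  refine continuousAt_iff_continuous_left'_right'.2 ⟨?_, ?_⟩
  · refine (monotone_cdf ν).continuousWithinAt_Iio_iff_leftLim_eq.2 ?_
    exact le_antisymm ((monotone_cdf ν).leftLim_le le_rfl) h1
  · exact ((cdf ν).right_continuous x).mono Set.Ioi_subset_Ici_self

end

/-! ### Noise integrals over the level sets of a simple function. -/

/-- The noise integral of `g ∘ P`, computed on the level sets of the simple function `P`. -/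
noncomputable def noiseSum {Ω E : Type*} (W : Set Plane → Ω → ℝ) (P : SimpleFunc Plane E)
    (g : E → ℝ) (ω : Ω) : ℝ :=
  ∑ p ∈ P.range, g p * W (P ⁻¹' {p}) ω

/-- The level sets of a simple function, the one of `0` being replaced by `∅`. -/
def levelSet {E : Type*} [Zero E] (P : SimpleFunc Plane E) (p : E) : Set Plane :=
  {x | P x = p ∧ p ≠ 0}

theorem levelSet_zero {E : Type*} [Zero E] (P : SimpleFunc Plane E) : levelSet P 0 = ∅ := by
  simp [levelSet]

theorem levelSet_of_ne {E : Type*} [Zero E] (P : SimpleFunc Plane E) {p : E} (hp : p ≠ 0) :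
    levelSet P p = P ⁻¹' {p} := by
  ext x; simp [levelSet, hp]

theorem measurableSet_levelSet {E : Type*} [Zero E] (P : SimpleFunc Plane E) (p : E) :
    MeasurableSet (levelSet P p) := by
  by_cases hp : p = 0
  · simp [hp, levelSet_zero]
  · rw [levelSet_of_ne P hp]
    exact P.measurableSet_preimage _

theorem disjoint_levelSet {E : Type*} [Zero E] (P : SimpleFunc Plane E) {p q : E} (h : p ≠ q) :
    Disjoint (levelSet P p) (levelSet P q) :=
  Set.disjoint_left.2 fun _ hx hy => h (hx.1.symm.trans hy.1)

theorem volume_levelSet_lt_top {E : Type*} [NormedAddCommGroup E] {P : SimpleFunc Plane E}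
    (hP : Integrable P) (p : E) : volume (levelSet P p) < ⊤ := by
  by_cases hp : p = 0
  · simp [hp, levelSet_zero]
  · rw [levelSet_of_ne P hp]
    exact SimpleFunc.measure_preimage_lt_top_of_integrable P hP hp

/-- The set where P = 0 may have infinite area, where nothing is known about `W`; its coefficient
g(0) = 0 makes this harmless. -/
theorem noiseSum_eq {Ω E : Type*} [Zero E] (W : Set Plane → Ω → ℝ) (P : SimpleFunc Plane E)
    {g : E → ℝ} (hg : g 0 = 0) (ω : Ω) :
    noiseSum W P g ω = ∑ p ∈ P.range, g p * W (levelSet P p) ω := by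
  refine Finset.sum_congr rfl fun p _ => ?_
  by_cases hp : p = 0
  · simp [hp, hg]
  · rw [levelSet_of_ne P hp]

theorem sum_volume_levelSet {E : Type*} [NormedAddCommGroup E] {P : SimpleFunc Plane E}
    (hP : Integrable P) {g : E → ℝ} (hg : g 0 = 0) :
    ∑ p ∈ P.range, (volume (levelSet P p)).toReal * g p = ∫ x, g (P x) := by
  have h1 := SimpleFunc.map_integral P g hP hg
  have hint : Integrable (P.map g) := by
    rw [SimpleFunc.integrable_iff_finMeasSupp] at hP ⊢
    exact hP.map hg
  have h2 := SimpleFunc.integral_eq_integral (P.map g) hint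
  rw [h1, SimpleFunc.coe_map] at h2
  refine Eq.trans ?_ h2
  refine Finset.sum_congr rfl fun p _ => ?_
  by_cases hp : p = 0
  · simp [hp, hg]
  · rw [levelSet_of_ne P hp, smul_eq_mul, measureReal_def]

/-! ### Finite additivity, independence and laws of noise integrals. -/

namespace IsCauchyWhiteNoise

variable {Ω : Type*} [MeasurableSpace Ω] {μ : Measure Ω}
  {W : Set Plane → Ω → ℝ}

theorem apply_empty (hW : IsCauchyWhiteNoise μ W) : ∀ᵐ ω ∂μ, W ∅ ω = 0 := by
  have h := hW.law ∅ MeasurableSet.empty (by simp)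
  simp only [measure_empty, ENNReal.toNNReal_zero, cauchyMeasure_zero_scale] at h
  have h2 : ∀ᵐ x ∂(μ.map (W ∅)), x = 0 := by
    rw [h.map_eq]
    simp
  exact ae_of_ae_map h.aemeasurable h2

theorem union (hW : IsCauchyWhiteNoise μ W) {A B : Set Plane} (hA : MeasurableSet A)
    (hB : MeasurableSet B) (hA' : volume A < ⊤) (hB' : volume B < ⊤) (hAB : Disjoint A B) :
    ∀ᵐ ω ∂μ, W (A ∪ B) ω = W A ω + W B ω := by
  -- Padding with empty sets reduces finite to countable additivity, since W(∅) = 0 almost surely.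
  set C : ℕ → Set Plane := fun n => if n = 0 then A else if n = 1 then B else ∅ with hC
  have hU : ⋃ i, C i = A ∪ B := by
    ext x
    simp only [Set.mem_iUnion, Set.mem_union]
    refine ⟨fun ⟨i, hi⟩ => ?_, fun h => ?_⟩
    · simp only [hC] at hi
      split_ifs at hi
      exacts [Or.inl hi, Or.inr hi, absurd hi (Set.notMem_empty x)]
    · rcases h with h | h
      exacts [⟨0, by simpa [hC] using h⟩, ⟨1, by simpa [hC] using h⟩]
  have h1 := hW.additive C (fun i => by simp only [hC]; split_ifs <;> simp [hA, hB])
    (by rw [hU]; exact measure_union_lt_top hA' hB') (by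
      intro i j hij
      simp only [hC]
      split_ifs <;> simp_all [hAB.symm])
  rw [hU] at h1
  filter_upwards [h1, hW.apply_empty] with ω h2 h3
  refine tendsto_nhds_unique h2 (tendsto_const_nhds.congr' ?_)
  filter_upwards [eventually_ge_atTop 2] with n hn
  rw [← Finset.sum_subset (Finset.range_mono hn)]
  · simp [Finset.sum_range_succ, hC]
  · intro i _ hi
    have : 1 < i := by simpa using hi
    have h4 : C i = ∅ := by
      simp only [hC]
      rw [if_neg (by lia), if_neg (by lia)]
    rw [h4, h3]

theorem biUnion (hW : IsCauchyWhiteNoise μ W) {ι : Type*} (s : Finset ι) {A : ι → Set Plane}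
    (hA : ∀ i ∈ s, MeasurableSet (A i)) (hA' : ∀ i ∈ s, volume (A i) < ⊤)
    (hd : ∀ i j, i ≠ j → Disjoint (A i) (A j)) :
    ∀ᵐ ω ∂μ, W (⋃ i ∈ s, A i) ω = ∑ i ∈ s, W (A i) ω := by
  classical
  induction s using Finset.induction_on with
  | empty => simpa using hW.apply_empty
  | insert i s hi ih =>
    have ih' := ih (fun j hj => hA j (Finset.mem_insert_of_mem hj))
      (fun j hj => hA' j (Finset.mem_insert_of_mem hj))
    have h1 := hW.union (hA i (Finset.mem_insert_self i s))
      (Finset.measurableSet_biUnion s fun j hj => hA j (Finset.mem_insert_of_mem hj))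
      (hA' i (Finset.mem_insert_self i s))
      ((measure_biUnion_lt_top s.finite_toSet fun j hj => hA' j (Finset.mem_insert_of_mem hj)))
      (Set.disjoint_iUnion₂_right.2 fun j hj => hd i j fun h => hi (h ▸ hj))
    filter_upwards [ih', h1] with ω h2 h3
    rw [Finset.set_biUnion_insert, Finset.sum_insert hi, h3, h2]

theorem iIndepFun_of_countable (hW : IsCauchyWhiteNoise μ W) {ι : Type*} [Countable ι]
    {A : ι → Set Plane} (hA : ∀ i, MeasurableSet (A i)) (hA' : ∀ i, volume (A i) < ⊤)
    (hd : Pairwise fun i j => Disjoint (A i) (A j)) : iIndepFun (fun i => W (A i)) μ := by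
  obtain ⟨e, he⟩ := exists_injective_nat ι
  have hcase : ∀ n, (∃ i, e i = n ∧ Function.extend e A (fun _ => ∅) n = A i) ∨
      Function.extend e A (fun _ => ∅) n = ∅ := by
    intro n
    by_cases hn : ∃ i, e i = n
    · obtain ⟨i, rfl⟩ := hn
      exact Or.inl ⟨i, rfl, he.extend_apply _ _ _⟩
    · exact Or.inr (Function.extend_apply' _ _ _ hn)
  have h := hW.indep (Function.extend e A fun _ => ∅)
    (fun n => by
      rcases hcase n with ⟨i, -, hi⟩ | hi <;> rw [hi]
      exacts [hA i, MeasurableSet.empty])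
    (fun n => by
      rcases hcase n with ⟨i, -, hi⟩ | hi <;> rw [hi]
      exacts [hA' i, by simp])
    (fun m n hmn => by
      rcases hcase m with ⟨i, hi', hi⟩ | hi
      · rcases hcase n with ⟨j, hj', hj⟩ | hj
        · rw [hi, hj]
          exact hd fun hij => hmn (by rw [← hi', ← hj', hij])
        · simp [hj]
      · simp [hi])
  have h2 := h.precomp he
  simpa only [he.extend_apply] using h2

section
variable {E : Type*} [NormedAddCommGroup E] {P : SimpleFunc Plane E}

theorem measurable_levelSet (hW : IsCauchyWhiteNoise μ W) (hP : Integrable P) (p : E) :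
    Measurable (W (levelSet P p)) :=
  hW.measurable _ (measurableSet_levelSet P p) (volume_levelSet_lt_top hP p)

theorem measurable_noiseSum (hW : IsCauchyWhiteNoise μ W) (hP : Integrable P) {g : E → ℝ}
    (hg : g 0 = 0) : Measurable (noiseSum W P g) := by
  have : noiseSum W P g = fun ω => ∑ p ∈ P.range, g p * W (levelSet P p) ω :=
    funext fun ω => noiseSum_eq W P hg ω
  rw [this]
  exact Finset.measurable_fun_sum _ fun p _ => (hW.measurable_levelSet hP p).const_mul _

theorem iIndepFun_levelSet (hW : IsCauchyWhiteNoise μ W) (hP : Integrable P) :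
    iIndepFun (fun p : P.range => W (levelSet P p)) μ :=
  hW.iIndepFun_of_countable (fun p => measurableSet_levelSet P p)
    (fun p => volume_levelSet_lt_top hP p)
    fun _ _ hpq => disjoint_levelSet P fun h => hpq (Subtype.ext h)

/-- Finite additivity over the fibres of h. It allows several simple functions to be integrated over
one common partition, the level sets of their joint vector. -/
theorem noiseSum_map (hW : IsCauchyWhiteNoise μ W) (hP : Integrable P) {F : Type*}
    [NormedAddCommGroup F] {h : E → F} (hh : h 0 = 0) {g : F → ℝ} (hg : g 0 = 0) :
    noiseSum W (P.map h) g =ᵐ[μ] noiseSum W P (g ∘ h) := by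
  classical
  have key : ∀ q ∈ (P.map h).range, ∀ᵐ ω ∂μ, g q * W ((P.map h) ⁻¹' {q}) ω =
      ∑ p ∈ P.range with h p = q, g (h p) * W (P ⁻¹' {p}) ω := by
    intro q _
    by_cases hq : q = 0
    · refine Eventually.of_forall fun ω => ?_
      rw [hq, hg, zero_mul, Finset.sum_eq_zero]
      intro p hp
      rw [(Finset.mem_filter.1 hp).2, hg, zero_mul]
    · have hne : ∀ p ∈ P.range.filter (fun p => h p = q), p ≠ 0 := fun p hp h0 =>
        hq (by rw [← (Finset.mem_filter.1 hp).2, h0, hh])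
      have hun : (P.map h) ⁻¹' {q} = ⋃ p ∈ P.range.filter (fun p => h p = q), P ⁻¹' {p} := by
        ext x
        simp
      have h1 := hW.biUnion (P.range.filter fun p => h p = q) (A := fun p => P ⁻¹' {p})
        (fun p _ => P.measurableSet_preimage _)
        (fun p hp => SimpleFunc.measure_preimage_lt_top_of_integrable P hP (hne p hp))
        (fun p p' hpp => Set.disjoint_left.2 fun x hx hx' => hpp (by
          rw [← show P x = p from hx, ← show P x = p' from hx']))
      filter_upwards [h1] with ω h2
      rw [hun, h2, Finset.mul_sum]
      exact Finset.sum_congr rfl fun p hp => by rw [(Finset.mem_filter.1 hp).2]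
  filter_upwards [(ae_ball_iff (Finset.countable_toSet _)).2 key] with ω hω
  simp only [noiseSum, Function.comp_apply]
  rw [Finset.sum_congr rfl hω]
  refine Finset.sum_fiberwise_of_maps_to (fun p hp => ?_) _
  rw [SimpleFunc.range_map]
  exact Finset.mem_image_of_mem h hp

variable [IsProbabilityMeasure μ]

/-- The characteristic functions exp(-|g(p)| |P = p| |t|) of the independent terms multiply, and the
exponents sum to -|t| ∫ |g ∘ P|. -/
theorem hasLaw_noiseSum (hW : IsCauchyWhiteNoise μ W) (hP : Integrable P) {g : E → ℝ}
    (hg : g 0 = 0) :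
    HasLaw (noiseSum W P g) (cauchyMeasure 0 (∫ x, |g (P x)|).toNNReal) μ := by
  have hm := hW.measurable_noiseSum hP hg
  refine ⟨hm.aemeasurable, ?_⟩
  have := Measure.isProbabilityMeasure_map (μ := μ) hm.aemeasurable
  refine Measure.ext_of_charFun ?_
  have hind : iIndepFun (P.range.restrict fun p ω => g p * W (levelSet P p) ω) μ :=
    (hW.iIndepFun_levelSet hP).comp (fun p x => g p * x) fun p => by fun_prop
  have h1 := iIndepFun.charFun_map_fun_finsetSum_eq_prod
    (fun p _ => ((hW.measurable_levelSet hP p).const_mul (g p)).aemeasurable) hind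
  have h2 : noiseSum W P g = fun ω => ∑ p ∈ P.range, g p * W (levelSet P p) ω :=
    funext fun ω => noiseSum_eq W P hg ω
  rw [h2, h1]
  ext t
  rw [charFun_cauchyMeasure, Real.coe_toNNReal _ (integral_nonneg fun x => abs_nonneg _),
    ← sum_volume_levelSet hP (g := fun p => |g p|) (by simp [hg]), Finset.prod_apply,
    ← Finset.sum_neg_distrib, Finset.sum_mul, Real.exp_sum, Complex.ofReal_prod]
  refine Finset.prod_congr rfl fun p _ => ?_
  have h3 := (hW.law _ (measurableSet_levelSet P p) (volume_levelSet_lt_top hP p))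
  have h4 := charFun_map_mul_comp (hW.measurable_levelSet hP p).aemeasurable (μ := μ) (g p) t
  rw [h4, h3.map_eq, charFun_cauchyMeasure, abs_mul]
  congr 2
  rw [ENNReal.coe_toNNReal_eq_toReal]
  ring

end

theorem measurable_simpleNoiseIntegral (hW : IsCauchyWhiteNoise μ W) {φ : SimpleFunc Plane ℝ}
    (hφ : Integrable φ) : Measurable (simpleNoiseIntegral W φ) :=
  hW.measurable_noiseSum (g := id) hφ rfl

variable [IsProbabilityMeasure μ]

theorem hasLaw_sub (hW : IsCauchyWhiteNoise μ W) {φ ψ : SimpleFunc Plane ℝ}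
    (hφ : Integrable φ) (hψ : Integrable ψ) :
    HasLaw (fun ω => simpleNoiseIntegral W φ ω - simpleNoiseIntegral W ψ ω)
      (cauchyMeasure 0 (∫ x, |φ x - ψ x|).toNNReal) μ := by
  have hP : Integrable (φ.pair ψ) := SimpleFunc.integrable_pair hφ hψ
  have h1 := hW.noiseSum_map hP (h := Prod.fst) rfl (g := id) rfl
  have h2 := hW.noiseSum_map hP (h := Prod.snd) rfl (g := id) rfl
  have h3 := hW.hasLaw_noiseSum hP (g := fun p => p.1 - p.2) (by simp)
  refine h3.congr ?_
  filter_upwards [h1, h2] with ω e1 e2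
  have e3 : simpleNoiseIntegral W φ ω = noiseSum W ((φ.pair ψ).map Prod.fst) id ω := rfl
  have e4 : simpleNoiseIntegral W ψ ω = noiseSum W ((φ.pair ψ).map Prod.snd) id ω := rfl
  rw [e3, e4, e1, e2]
  simp only [noiseSum, ← Finset.sum_sub_distrib, Function.comp_apply, id, sub_mul]

/-- The error made by replacing the integrand by a simple function is a Cauchy variable. -/
theorem hasLaw_noiseIntegral_sub (hW : IsCauchyWhiteNoise μ W) {f : Plane → ℝ}
    (hf : Integrable f) {X : Ω → ℝ} (hX : Measurable X) (hfX : IsNoiseIntegral μ W f X)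
    {ψ : SimpleFunc Plane ℝ} (hψ : Integrable ψ) :
    HasLaw (fun ω => X ω - simpleNoiseIntegral W ψ ω)
      (cauchyMeasure 0 (∫ x, |f x - ψ x|).toNNReal) μ := by
  obtain ⟨φ, hφ, hφf, hφX⟩ := hfX
  -- Along an almost surely convergent subsequence the characteristic functions converge by
  -- dominated convergence; L¹ convergence of the integrands identifies the limit through the Cauchy
  -- scales.
  obtain ⟨ns, hns, hae⟩ := hφX.exists_seq_tendsto_ae
  have hψm := hW.measurable_simpleNoiseIntegral hψ
  refine ⟨(hX.sub hψm).aemeasurable, ?_⟩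
  have := Measure.isProbabilityMeasure_map (μ := μ) (hX.sub hψm).aemeasurable
  refine Measure.ext_of_charFun ?_
  ext t
  have hchar : ∀ {Y : Ω → ℝ}, Measurable Y → charFun (μ.map Y) t =
      ∫ ω, Complex.exp (t * Y ω * Complex.I) ∂μ := fun {Y} hY => by
    rw [charFun_apply_real, integral_map hY.aemeasurable (by fun_prop)]
  have hlim : Tendsto (fun n => charFun (μ.map fun ω =>
      simpleNoiseIntegral W (φ (ns n)) ω - simpleNoiseIntegral W ψ ω) t) atTop
      (𝓝 (charFun (μ.map fun ω => X ω - simpleNoiseIntegral W ψ ω) t)) := by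
    rw [hchar (Y := fun ω => X ω - simpleNoiseIntegral W ψ ω) (hX.sub hψm)]
    have hm : ∀ n, Measurable fun ω =>
      simpleNoiseIntegral W (φ (ns n)) ω - simpleNoiseIntegral W ψ ω := fun n =>
        (hW.measurable_simpleNoiseIntegral (hφ (ns n))).sub hψm
    simp only [fun n => hchar (hm n)]
    refine tendsto_integral_of_dominated_convergence (fun _ => 1) (fun n => ?_)
      (integrable_const _) (fun n => Eventually.of_forall fun ω => ?_) ?_
    · have := hm n
      exact Measurable.aestronglyMeasurable (by fun_prop)
    · rw [← Complex.ofReal_mul, Complex.norm_exp_ofReal_mul_I]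
    · filter_upwards [hae] with ω hω
      have hc : Continuous fun x : ℝ => Complex.exp (t * x * Complex.I) := by fun_prop
      exact (hc.tendsto _).comp (hω.sub_const _)
  refine tendsto_nhds_unique hlim ?_
  simp only [(hW.hasLaw_sub (hφ _) hψ).map_eq, charFun_cauchyMeasure]
  have hL1 : Tendsto (fun n => ∫ x, |φ n x - ψ x|) atTop (𝓝 (∫ x, |f x - ψ x|)) := by
    refine tendsto_integral_of_L1' _ (hf.sub hψ).abs.aestronglyMeasurable
      (Eventually.of_forall fun n => ((hφ n).sub hψ).abs) ?_
    refine tendsto_of_tendsto_of_tendsto_of_le_of_le tendsto_const_nhds hφf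
      (fun n => zero_le) (fun n => eLpNorm_mono fun x => ?_)
    simp only [Pi.sub_apply, Real.norm_eq_abs]
    refine (abs_abs_sub_abs_le_abs_sub _ _).trans (le_of_eq ?_)
    congr 1
    ring
  have hcont : Continuous fun r : ℝ => ((Real.exp (-(r.toNNReal : ℝ) * |t|) : ℝ) : ℂ) := by
    fun_prop
  exact (hcont.tendsto _).comp (hL1.comp hns.tendsto_atTop)

end IsCauchyWhiteNoise

/-! ### Joint tail of noise integrals, and the Gaussian perturbation. -/

section
variable {d : ℕ}

theorem abs_iSup_mul_sub_iSup_mul_le {v : Fin d → ℝ} (hv : ∀ j, 0 ≤ v j) (a b : Fin d → ℝ) :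
    |(⨆ j, v j * a j) - ⨆ j, v j * b j| ≤ ∑ j, v j * |a j - b j| := by
  refine (abs_iSup_sub_iSup_le _ _).trans (le_of_eq (Finset.sum_congr rfl fun j _ => ?_))
  rw [← mul_sub, abs_mul, abs_of_nonneg (hv j)]

theorem continuous_iSup_mul {v : Fin d → ℝ} (hv : ∀ j, 0 ≤ v j) :
    Continuous fun a : Fin d → ℝ => ⨆ j, v j * a j := by
  refine continuous_iff_continuousAt.2 fun b => ?_
  have h : Tendsto (fun a : Fin d → ℝ => ∑ j, v j * |a j - b j|) (𝓝 b) (𝓝 0) := by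
    have hc : Continuous fun a : Fin d → ℝ => ∑ j, v j * |a j - b j| := by fun_prop
    simpa using hc.tendsto b
  refine tendsto_iff_dist_tendsto_zero.2
    (squeeze_zero (fun _ => dist_nonneg) (fun a => ?_) h)
  exact abs_iSup_mul_sub_iSup_mul_le hv a b

theorem integrable_iSup_mul {v : Fin d → ℝ} (hv : ∀ j, 0 ≤ v j) {k : Fin d → Plane → ℝ}
    (hk : ∀ j, Integrable (k j)) : Integrable fun x => ⨆ j, v j * k j x := by
  have hK : Integrable fun x j => k j x := Integrable.of_eval hk
  have hg : Integrable fun x => ∑ j, v j * |k j x| :=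
    integrable_finsetSum _ fun j _ => (hk j).abs.const_mul _
  refine hg.mono' ((continuous_iSup_mul hv).comp_aestronglyMeasurable hK.aestronglyMeasurable)
    (Eventually.of_forall fun x => ?_)
  simpa using abs_iSup_mul_sub_iSup_mul_le hv (fun j => k j x) 0

theorem abs_integral_iSup_mul_sub_le {v : Fin d → ℝ} (hv : ∀ j, 0 ≤ v j)
    {k l : Fin d → Plane → ℝ} (hk : ∀ j, Integrable (k j)) (hl : ∀ j, Integrable (l j)) :
    |(∫ x, ⨆ j, v j * k j x) - ∫ x, ⨆ j, v j * l j x| ≤ ∑ j, v j * ∫ x, |k j x - l j x| := by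
  rw [← integral_sub (integrable_iSup_mul hv hk) (integrable_iSup_mul hv hl)]
  refine (abs_integral_le_integral_abs).trans ?_
  have hi : ∀ j, Integrable fun x => v j * |k j x - l j x| := fun j =>
    ((hk j).sub (hl j)).abs.const_mul _
  simp only [← integral_const_mul]
  rw [← integral_finsetSum _ fun j _ => hi j]
  refine integral_mono ((integrable_iSup_mul hv hk).sub (integrable_iSup_mul hv hl)).abs
    (integrable_finsetSum _ fun j _ => hi j) fun x => ?_
  exact abs_iSup_mul_sub_iSup_mul_le hv (fun j => k j x) (fun j => l j x)

/-- Simultaneous approximation of nonnegative integrable functions by the coordinates of a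
nonnegative simple function. -/
theorem exists_simpleFunc_nonneg_integral_sub_le {k : Fin d → Plane → ℝ}
    (hk0 : ∀ j x, 0 ≤ k j x) (hk : ∀ j, Integrable (k j)) {ε : ℝ} (hε : 0 < ε) :
    ∃ Ψ : SimpleFunc Plane (Fin d → ℝ), Integrable Ψ ∧ (∀ x j, 0 ≤ Ψ x j) ∧
      ∀ j, ∫ x, |k j x - Ψ x j| ≤ ε := by
  have hK : Integrable fun x j => k j x := Integrable.of_eval hk
  obtain ⟨Φ, hΦ, hΦi⟩ := (memLp_one_iff_integrable.2 hK).exists_simpleFunc_eLpNorm_sub_lt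
    ENNReal.one_ne_top (ENNReal.ofReal_pos.2 hε).ne'
  rw [memLp_one_iff_integrable] at hΦi
  -- Taking positive parts is 1-Lipschitz and fixes k ≥ 0, so it gives nonnegativity without
  -- increasing the error.
  have hmap : ∀ x j, (Φ.map fun p j => max (p j) 0) x j = max (Φ x j) 0 := fun x j => rfl
  have hint : Integrable (Φ.map fun p j => max (p j) 0) :=
    Integrable.of_eval fun j => (hΦi.eval j).pos_part
  refine ⟨Φ.map fun p j => max (p j) 0, hint, fun x j => le_max_right _ _, fun j => ?_⟩
  have hsub : Integrable ((fun x j => k j x) - ⇑Φ) := hK.sub hΦi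
  rw [eLpNorm_one_eq_lintegral_enorm, ← ofReal_integral_norm_eq_lintegral_enorm hsub] at hΦ
  refine le_trans ?_ ((ENNReal.ofReal_lt_ofReal_iff hε).1 hΦ).le
  refine integral_mono ((hk j).sub (hint.eval j)).abs hsub.norm fun x => ?_
  refine le_trans ?_ (norm_le_pi_norm (((fun x j => k j x) - ⇑Φ) x) j)
  simp only [Pi.sub_apply, Real.norm_eq_abs, hmap]
  have := abs_max_sub_max_le_abs (k j x) (Φ x j) 0
  rwa [max_eq_left (hk0 j x)] at this

variable {Ω : Type*} [MeasurableSpace Ω] {μ : Measure Ω} [IsProbabilityMeasure μ]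

theorem IsCauchyWhiteNoise.hasTail_noiseSum {W : Set Plane → Ω → ℝ}
    (hW : IsCauchyWhiteNoise μ W) {Ψ : SimpleFunc Plane (Fin d → ℝ)} (hΨ : Integrable Ψ)
    (hpos : ∀ x j, 0 ≤ Ψ x j) :
    HasTail μ (fun j => noiseSum W Ψ fun p => p j)
      (fun v => Real.pi⁻¹ * ∫ x, ⨆ j, v j * Ψ x j) := by
  have hpos' : ∀ (p : Ψ.range) j, 0 ≤ p.1 j := fun p j => by
    obtain ⟨x, hx⟩ := SimpleFunc.mem_range.1 p.2
    rw [← hx]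
    exact hpos x j
  have hlaw : ∀ p : Ψ.range, HasLaw (W (levelSet Ψ p))
      (cauchyMeasure 0 (volume (levelSet Ψ p)).toNNReal) μ := fun p =>
    hW.law _ (measurableSet_levelSet Ψ p) (volume_levelSet_lt_top hΨ p)
  have h := HasTail.sum (μ := μ) (X := fun (p : Ψ.range) j ω => p.1 j * W (levelSet Ψ p) ω)
    Finset.univ (fun p => HasTail.of_cauchy (hlaw p) (hpos' p))
    (fun p j => HasWeakBound.const_mul
      (fun t ht => (hlaw p).mul_measureReal_lt_abs_cauchy_le ht) (hpos' p j))
    (fun p j => (hW.measurable_levelSet hΨ p).const_mul _)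
    ((hW.iIndepFun_levelSet hΨ).comp (fun p x j => p.1 j * x) fun p => by fun_prop)
  have e1 : (fun (j : Fin d) ω => ∑ p : Ψ.range, p.1 j * W (levelSet Ψ p) ω) =
      fun j => noiseSum W Ψ fun p => p j := by
    ext j ω
    rw [noiseSum_eq W Ψ rfl]
    exact Finset.sum_coe_sort Ψ.range fun p => p j * W (levelSet Ψ p) ω
  have e2 : (fun v : Fin d → ℝ => ∑ p : Ψ.range,
      Real.pi⁻¹ * ((volume (levelSet Ψ p)).toNNReal * ⨆ j, v j * p.1 j)) =
      fun v => Real.pi⁻¹ * ∫ x, ⨆ j, v j * Ψ x j := by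
    ext v
    rw [← Finset.mul_sum, ← sum_volume_levelSet hΨ (g := fun p => ⨆ j, v j * p j) (by simp)]
    congr 1
    exact Finset.sum_coe_sort Ψ.range
      fun p => (volume (levelSet Ψ p)).toReal * ⨆ j, v j * p j
  rw [← e1, ← e2]
  exact h

/-- The joint upper tail of finitely many noise integrals of nonnegative functions. -/
theorem IsCauchyWhiteNoise.hasTail_noiseIntegral {W : Set Plane → Ω → ℝ}
    (hW : IsCauchyWhiteNoise μ W) {k : Fin d → Plane → ℝ} (hk0 : ∀ j x, 0 ≤ k j x)
    (hk : ∀ j, Integrable (k j)) {X : Fin d → Ω → ℝ} (hX : ∀ j, Measurable (X j))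
    (hkX : ∀ j, IsNoiseIntegral μ W (k j) (X j)) :
    HasTail μ X (fun v => Real.pi⁻¹ * ∫ x, ⨆ j, v j * k j x) := by
  refine HasTail.of_approx fun η hη => ?_
  -- Half of η, because the weak bound of a Cauchy variable is twice its scale.
  obtain ⟨Ψ, hΨ, hpos, hkΨ⟩ := exists_simpleFunc_nonneg_integral_sub_le hk0 hk (half_pos hη)
  have hΨj : ∀ j, Integrable (Ψ.map fun p => p j) := fun j => hΨ.eval j
  have hYm : ∀ j, noiseSum W Ψ (fun p => p j) =ᵐ[μ]
      simpleNoiseIntegral W (Ψ.map fun p => p j) := fun j =>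
    (hW.noiseSum_map hΨ (h := fun p : Fin d → ℝ => p j) rfl (g := id) rfl).symm
  have hT : HasTail μ (fun j => simpleNoiseIntegral W (Ψ.map fun p => p j))
      (fun v => Real.pi⁻¹ * ∫ x, ⨆ j, v j * Ψ x j) :=
    (hW.hasTail_noiseSum hΨ hpos).congr_ae hYm
  refine ⟨_, _, hT, fun v hv => ?_, fun j => ?_⟩
  · rw [← mul_sub, abs_mul, abs_of_pos (inv_pos.2 Real.pi_pos), abs_sub_comm]
    have h1 := abs_integral_iSup_mul_sub_le hv hk fun j => hΨj j
    have h2 : ∑ j, v j * ∫ x, |k j x - Ψ x j| ≤ (∑ j, v j) * (η / 2) := by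
      rw [Finset.sum_mul]
      exact Finset.sum_le_sum fun j _ => mul_le_mul_of_nonneg_left (hkΨ j) (hv j)
    have h3 : 0 ≤ ∑ j, v j := Finset.sum_nonneg fun j _ => hv j
    have h4 : Real.pi⁻¹ ≤ 1 := inv_le_one_of_one_le₀ (by linarith [Real.pi_gt_three])
    refine (mul_le_of_le_one_left (abs_nonneg _) h4).trans (h1.trans (h2.trans ?_))
    nlinarith
  · have h1 := hW.hasLaw_noiseIntegral_sub (hk j) (hX j) (hkX j) (hΨj j)
    filter_upwards [eventually_gt_atTop 0] with t ht
    refine (h1.mul_measureReal_lt_abs_cauchy_le ht).trans ?_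
    rw [Real.coe_toNNReal _ (integral_nonneg fun x => abs_nonneg _)]
    have := hkΨ j
    change 2 * ∫ x, |k j x - Ψ x j| ≤ η
    linarith

theorem IsCauchyWhiteNoise.hasLaw_noiseIntegral {W : Set Plane → Ω → ℝ}
    (hW : IsCauchyWhiteNoise μ W) {f : Plane → ℝ} (hf0 : ∀ x, 0 ≤ f x) (hf : Integrable f)
    {X : Ω → ℝ} (hX : Measurable X) (hfX : IsNoiseIntegral μ W f X) :
    HasLaw X (cauchyMeasure 0 (∫ x, f x).toNNReal) μ := by
  have h := hW.hasLaw_noiseIntegral_sub hf hX hfX (ψ := 0) (integrable_zero _ _ _)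
  have e1 : ∀ x, |f x - (0 : SimpleFunc Plane ℝ) x| = f x := fun x => by
    simp [abs_of_nonneg (hf0 x)]
  simp only [e1] at h
  refine h.congr (Eventually.of_forall fun ω => ?_)
  have : simpleNoiseIntegral W 0 ω = 0 := Finset.sum_eq_zero fun y hy => by
    obtain ⟨x, rfl⟩ := SimpleFunc.mem_range.1 hy
    simp
  simp [this]

/-- By Chebyshev, t P(|R_j| > t) ≤ E[R_j²]/t → 0, so X itself approximates X + R in the sense of
`HasTail.of_approx`, whatever the dependence between them. -/
theorem HasTail.add_of_memLp_two {X R : Fin d → Ω → ℝ} {Λ : (Fin d → ℝ) → ℝ}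
    (h : HasTail μ X Λ) (hR : ∀ j, MemLp (R j) 2 μ) :
    HasTail μ (fun j ω => X j ω + R j ω) Λ := by
  refine HasTail.of_approx fun η hη => ⟨X, Λ, h, fun v hv => ?_, fun j => ?_⟩
  · have : 0 ≤ ∑ j, v j := Finset.sum_nonneg fun j _ => hv j
    simp only [sub_self, abs_zero]
    positivity
  · simp only [add_sub_cancel_left]
    have hlim : Tendsto (fun t : ℝ => (∫ ω, R j ω ^ 2 ∂μ) / t) atTop (𝓝 0) :=
      tendsto_const_nhds.div_atTop tendsto_id
    filter_upwards [eventually_gt_atTop 0, hlim.eventually_lt_const hη] with t ht hlt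
    have h1 := mul_meas_ge_le_integral_of_nonneg (μ := μ) (f := fun ω => R j ω ^ 2)
      (Eventually.of_forall fun ω => sq_nonneg _) (hR j).integrable_sq (t ^ 2)
    have h2 : μ.real {ω | t < |R j ω|} ≤ μ.real {ω | t ^ 2 ≤ R j ω ^ 2} := by
      refine measureReal_mono fun ω hω => ?_
      have h3 : t < |R j ω| := hω
      simp only [Set.mem_ofPred_eq, ← sq_abs (R j ω)]
      gcongr
    refine le_trans ?_ hlt.le
    rw [le_div_iff₀ ht]
    have h4 := mul_le_mul_of_nonneg_left h2 (sq_nonneg t)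
    linarith

/-- Convolving an absolutely continuous law with any probability law keeps it absolutely continuous;
this covers β = 0, where the second law is a point mass. -/
theorem continuous_cdf_map_add {X Y : Ω → ℝ} (hX : AEMeasurable X μ) (hY : AEMeasurable Y μ)
    (hac : μ.map X ≪ volume) (hXY : IndepFun X Y μ) :
    Continuous (cdf (μ.map fun ω => X ω + Y ω)) := by
  have h := hXY.symm.map_add_eq_map_conv_map₀ hY hX
  have hac' : μ.map (fun ω => X ω + Y ω) ≪ volume := by
    have e : (fun ω => X ω + Y ω) = Y + X := by ext ω; simp [add_comm]
    have := Measure.isProbabilityMeasure_map hX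
    rw [e, h]
    exact Measure.conv_absolutelyContinuous hac
  have := Measure.isProbabilityMeasure_map (hX.add hY)
  exact continuous_cdf_of_absolutelyContinuous hac'

end

/-! ### The main theorem. -/

theorem proposition3 {Ω : Type*} [MeasurableSpace Ω] (μ : Measure Ω) [IsProbabilityMeasure μ]
    (k : Plane → Plane → ℝ)
    (hk_nonneg : ∀ s x, 0 ≤ k s x)
    (hk_bdd : ∃ kmax : ℝ, ∀ s x, k s x ≤ kmax)
    (hk_int : ∀ s, Integrable (k s))
    (W : Set Plane → Ω → ℝ) (hW : IsCauchyWhiteNoise μ W)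
    (Z : Plane → Ω → ℝ) (hZ : IsCauchyConvolution μ W k Z)
    (ZG : Plane → Ω → ℝ) (hG : IsStationaryStdGaussian μ ZG)
    (hindep : IndepFun (fun ω s => Z s ω) (fun ω s => ZG s ω) μ)
    (β : ℝ) (hβ : 0 ≤ β)
    (d : ℕ) (s : Fin d → Plane)
    (hs : ∀ j, 0 < ∫ x, k (s j) x) :
    HasStableTailDependenceFunction μ (fun j => Z (s j)) (movingMaximumTail k s) ∧
    HasStableTailDependenceFunction μ (fun j ω => Z (s j) ω + β * ZG (s j) ω)
      (movingMaximumTail k s) := by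
  have hlaw : ∀ j, HasLaw (Z (s j)) (cauchyMeasure 0 (∫ x, k (s j) x).toNNReal) μ := fun j =>
    hW.hasLaw_noiseIntegral (hk_nonneg (s j)) (hk_int (s j)) (hZ (s j)).1 (hZ (s j)).2
  have hac : ∀ j, μ.map (Z (s j)) ≪ volume := fun j => by
    rw [(hlaw j).map_eq]
    exact cauchyMeasure_absolutelyContinuous (Real.toNNReal_pos.2 (hs j)).ne'
  have hT := hW.hasTail_noiseIntegral (fun j => hk_nonneg (s j)) (fun j => hk_int (s j))
    (fun j => (hZ (s j)).1) (fun j => (hZ (s j)).2)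
  set Λ : (Fin d → ℝ) → ℝ := fun v => Real.pi⁻¹ * ∫ x, ⨆ j, v j * k (s j) x with hΛ
  -- At e_j the other coordinates contribute 0, which is at most k(s_j, x), so the maximum is k(s_j,
  -- x).
  have hsingle : ∀ j, Λ (Pi.single j 1) = Real.pi⁻¹ * ∫ x, k (s j) x := by
    intro j
    simp only [hΛ]
    congr 2
    ext x
    have : Nonempty (Fin d) := ⟨j⟩
    refine le_antisymm (ciSup_le fun i => ?_) ?_
    · by_cases hi : i = j
      · subst hi; simp
      · simp [hi, hk_nonneg]
    · refine le_of_eq_of_le ?_ (le_ciSup (Set.finite_range _).bddAbove j)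
      simp
  have hpos : ∀ j, 0 < Λ (Pi.single j 1) := fun j => by
    rw [hsingle]
    exact mul_pos (inv_pos.2 Real.pi_pos) (hs j)
  -- The factor π⁻¹ of Λ cancels against the one in each marginal constant, leaving the normalized
  -- kernel.
  have hℓ : (fun w => Λ fun j => w j / Λ (Pi.single j 1)) = movingMaximumTail k s := by
    ext w
    simp only [hsingle]
    simp only [hΛ, movingMaximumTail, normalizedKernel]
    rw [← integral_const_mul]
    congr 1
    ext x
    rw [Real.mul_iSup_of_nonneg (inv_nonneg.2 Real.pi_pos.le)]
    congr 1
    ext j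
    have := (hs j).ne'
    generalize ∫ x, k (s j) x = c at this
    field_simp
  have hGm : ∀ j, AEMeasurable (ZG (s j)) μ := fun j => (hG.margin (s j)).aemeasurable
  have hGL : ∀ j, MemLp (fun ω => β * ZG (s j) ω) 2 μ := fun j => by
    refine MemLp.const_mul ?_ β
    have h1 : MemLp id 2 (μ.map (ZG (s j))) := by
      rw [(hG.margin (s j)).map_eq]
      exact memLp_id_gaussianReal 2
    exact (memLp_map_measure_iff h1.aestronglyMeasurable (hGm j)).1 h1
  rw [← hℓ]
  refine ⟨hT.hasStableTailDependenceFunction (fun j => (hlaw j).aemeasurable) (fun j => ?_) hpos,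
    (hT.add_of_memLp_two hGL).hasStableTailDependenceFunction
      (fun j => (hlaw j).aemeasurable.add ((hGm j).const_mul β)) (fun j => ?_) hpos⟩
  · have := Measure.isProbabilityMeasure_map (hlaw j).aemeasurable
    exact continuous_cdf_of_absolutelyContinuous (hac j)
  · refine continuous_cdf_map_add (hlaw j).aemeasurable ((hGm j).const_mul β) (hac j) ?_
    have hm : Measurable fun z : Plane → ℝ => z (s j) := measurable_pi_apply (s j)
    exact hindep.comp hm (hm.const_mul β)
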